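/- Let $k \ge 0$ and $n \ge 2$ be integers. The game $\mathrm{CHSH}_n + k$ has $k+2$ players, Alice, Bob and $\mathrm{Charlie}_1, \dots, \mathrm{Charlie}_k$, who cannot communicate; each player who is asked replies with a bit, and we write $X$, $Y$, $Z_1, \dots, Z_k$ for the answers and $A$, $B$, $C_1, \dots, C_k$ for the inputs. Put $p = \frac{1}{2n-1}$ and $q = \frac{(3^k-1)p}{1+(3^k-1)p}$. With probability $q$ the verifier asks a *consistency question*: for a uniformly random $J \in \{1, \dots, k\}$ she sends $A = 0$ to Alice and $C_J = 0$ to $\mathrm{Charlie}_J$ (the others are not asked) and accepts if $X = Z_J$. With probability $1-q$ she asks a *game question*: $A = 0$ with probability $p$, and otherwise $A$ is uniform in $\{-n+1, \dots, n-1\} \setminus \{0\}$; $B$ is uniform in $\{|A|, |A|+1 \bmod n\}$; if $A \ne 0$, also $C_1 = \dots = C_k = 1$ are sent (if $A = 0$ the Charlies are not asked). If $A = 0$ she accepts when $X = Y$. If $A \neq 0$, let $S = 1$ if $A < 0$ and $S = 0$ if $A > 0$, and $Z = Z_1 \oplus \dots \oplus Z_k$; she accepts if $Z \ne S$, or if $Z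 = S$ and $X \ne Y$ in the case $|A| = B = n-1$, or if $Z = S$ and $X = Y$ in all other cases. A multi-round non-signaling resource shared by a set of players takes from each of these players successive inputs, and returns an output after each; it is given by conditional distributions of the output sequences given the input sequences such that, for all $(j_i)_i$, the joint distribution of the first $j_i$ outputs of each player $i$ depends only on the first $j_i$ inputs of each player $i$. (Ordinary non-signaling distributions are the one-round case.) Consider classical players who have shared randomness and finitely many independent such resources, each of them shared by at most $k+1$ of the players, and who query them adaptively in any order. Let $\omega_q(\mathrm{CHSH}_n+k)$ be the supremum of the winning probabilities of quantum players, who share an arbitrary finite-dimensional multipartite state and make local measurements. Then every such classical strategy satisfies $$\Pr[\text{win}] \le 1 - \frac{1}{2(2n + 3^k - 2)},$$ and $$1 - \frac{1}{2(2n + 3^k - 2)} < \omega_q(\mathrm{CHSH}_n + k), \qquad 1 - \frac{1}{2n^2} < \omega_q(\mathrm{CHSH}_n + k).$$ -/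

import Mathlib

open scoped ENNReal ComplexOrder

noncomputable section

namespace ChainedBell

/-! ### Players, behaviours and the game -/

/-- The `k + 2` players: Alice, Bob and `k` Charlies. -/
inductive Player (k : ℕ) where
  | alice : Player k
  | bob : Player k
  | charlie (j : Fin k) : Player k
  deriving DecidableEq, Fintype

/-- A question sends an input to some of the players; `none` means that the player is not asked. -/
abbrev Question (P : Type*) := P → Option ℤ

/-- A behaviour gives, for every question, the probabilities of the tuples of answer bits.
By convention, a player who is not asked does nothing and has the dummy answer `false`. -/
abbrev Behaviour (P : Type*) := Question P → (P → Bool) → ℝ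

/-- The probability of an accepted answer to the question `Q`, for an acceptance predicate. -/
def acceptProb {P : Type*} [Fintype P] [DecidableEq P] (p : Behaviour P) (Q : Question P)
    (accept : (P → Bool) → Prop) : ℝ :=
  open Classical in ∑ x : P → Bool, if accept x then p Q x else 0

/-- The `j`-th consistency question: Alice and the `j`-th Charlie get the input `0`. -/
def consistencyQuestion {k : ℕ} (j : Fin k) : Question (Player k)
  | .alice => some 0
  | .bob => none
  | .charlie i => if i = j then some 0 else none

/-- Acceptance for the `j`-th consistency question: `X = Z_j`. -/
def ConsistencyAccept {k : ℕ} (j : Fin k) (x : Player k → Bool) : Prop :=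
  x .alice = x (.charlie j)

/-- The game question with inputs `a` for Alice and `b` for Bob; all Charlies get `1` if `a ≠ 0`
and are not asked if `a = 0`. -/
def gameQuestion {k : ℕ} (a b : ℤ) : Question (Player k)
  | .alice => some a
  | .bob => some b
  | .charlie _ => if a = 0 then none else some 1

/-- The exclusive or of the answers of the Charlies. -/
def charlieParity {k : ℕ} (x : Player k → Bool) : Bool :=
  decide (Odd (Finset.univ.filter fun j : Fin k => x (.charlie j) = true).card)

/-- Acceptance for the game question with inputs `a` and `b`. -/
def GameAccept (n : ℕ) {k : ℕ} (a b : ℤ) (x : Player k → Bool) : Prop :=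
  (a = 0 ∧ x .alice = x .bob) ∨
  (a ≠ 0 ∧ charlieParity x ≠ decide (a < 0)) ∨
  (a ≠ 0 ∧ charlieParity x = decide (a < 0) ∧
    if |a| = (n : ℤ) - 1 ∧ b = (n : ℤ) - 1 then x .alice ≠ x .bob else x .alice = x .bob)

/-- The probability that Alice's input is `0`, given a game question. -/
def zeroProb (n : ℕ) : ℝ := 1 / (2 * n - 1)

/-- The probability of a consistency question: `1 / (1 + 1 / ((3 ^ k - 1) p))`, written so that it
is `0` for `k = 0`, when there is no consistency question. -/
def consistencyProb (n k : ℕ) : ℝ :=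
  (3 ^ k - 1) * zeroProb n / (1 + (3 ^ k - 1) * zeroProb n)

/-- The probability that Alice's input is `a`, given a game question, for `|a| ≤ n - 1`. -/
def aliceInputProb (n : ℕ) (a : ℤ) : ℝ :=
  if a = 0 then zeroProb n else (1 - zeroProb n) / (2 * n - 2)

/-- The probability of winning the `k`-extended chained Bell game with a given behaviour. -/
def winProb (n k : ℕ) (p : Behaviour (Player k)) : ℝ :=
  consistencyProb n k *
      ((1 / k) * ∑ j : Fin k, acceptProb p (consistencyQuestion j) (ConsistencyAccept j)) +
  (1 - consistencyProb n k) *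
      ∑ a ∈ Finset.Icc (-(n : ℤ) + 1) ((n : ℤ) - 1), aliceInputProb n a *
        ((1 / 2) * acceptProb p (gameQuestion a |a|) (GameAccept n a |a|) +
         (1 / 2) * acceptProb p (gameQuestion a ((|a| + 1) % n)) (GameAccept n a ((|a| + 1) % n)))

/-! ### Classical players with non-signaling resources -/

/-- A multi-round non-signaling resource shared by the players in `members`, with input alphabet
`I` and output alphabet `O`. Each member can make successive queries, at any time; given the
finite sequences of inputs of all members, the resource has a distribution on the sequences of
outputs. The first `j i` outputs of every member `i` are distributed as if each member `i` had only
given its first `j i` inputs. A single-round resource is the case in which only the first output of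
every member is of interest. -/
structure NSResource (P I O : Type*) where
  members : Finset P
  prob : (members → List I) → PMF (members → List O)
  length_eq : ∀ a, ∀ x ∈ (prob a).support, ∀ i, (x i).length = (a i).length
  nonsignaling : ∀ (a : members → List I) (j : members → ℕ),
    (prob a).map (fun x i => (x i).take (j i)) = prob (fun i => (a i).take (j i))

/-- A deterministic adaptive protocol of a single player: either give the final answer, or query
a resource from `R` and continue depending on its output. -/
inductive Protocol (R I O : Type*) where
  | answer (b : Bool) : Protocol R I O
  | query (r : R) (a : I) (next : O → Protocol R I O) : Protocol R I O

/-- `Produces π h b`: following `π`, the player can make exactly the queries and receive exactly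
the outputs recorded in `h` (triples of resource, input, output), and then answer `b`. -/
inductive Protocol.Produces {R I O : Type*} :
    Protocol R I O → List (R × I × O) → Bool → Prop where
  | answer (b : Bool) : Protocol.Produces (.answer b) [] b
  | query (r : R) (a : I) (next : O → Protocol R I O) (o : O) (h : List (R × I × O)) (b : Bool) :
      Protocol.Produces (next o) h b → Protocol.Produces (.query r a next) ((r, a, o) :: h) b

/-- A strategy of classical players with `m` non-signaling resources: there is shared randomness
in `Ω` (which includes private randomness); each player, depending on it and on the input received,
follows an adaptive protocol that queries only resources of which the player is a member.
The alphabets `I` and `O` are common to all resources (take unions otherwise). -/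
structure NSStrategy (P : Type*) (m : ℕ) (I O Ω : Type*) where
  resource : Fin m → NSResource P I O
  seed : PMF Ω
  protocol : Ω → ∀ i : P, ℤ → Protocol {r : Fin m // i ∈ (resource r).members} I O

namespace NSStrategy

variable {P : Type*} {m : ℕ} {I O Ω : Type*}

/-- Every resource is shared by at most `l` players. -/
def IsLocal (S : NSStrategy P m I O Ω) (l : ℕ) : Prop :=
  ∀ r, (S.resource r).members.card ≤ l

/-- The interaction records of one player. -/
abbrev Record (S : NSStrategy P m I O Ω) (i : P) : Type _ :=
  List ({r : Fin m // i ∈ (S.resource r).members} × I × O)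

/-- What the players do on a question, given the shared randomness. -/
def protocolOn (S : NSStrategy P m I O Ω) (ω : Ω) (Q : Question P) (i : P) :
    Protocol {r : Fin m // i ∈ (S.resource r).members} I O :=
  match Q i with
  | none => .answer false
  | some a => S.protocol ω i a

/-- The probability that the (independent) resources give the recorded outputs on the recorded
inputs. -/
def recordWeight (S : NSStrategy P m I O Ω) (h : ∀ i, S.Record i) : ℝ≥0∞ :=
  ∏ r : Fin m, (S.resource r).prob
    (fun i => ((h i).filter fun e => e.1.val = r).map fun e => e.2.1)
    (fun i => ((h i).filter fun e => e.1.val = r).map fun e => e.2.2)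

/-- The probabilities of the answers: the total weight of all tuples of complete records that are
consistent with the protocols of the players. By the chain rule and the non-signaling property this
describes the execution for every order in which the players make their queries. -/
def behaviour (S : NSStrategy P m I O Ω) : Behaviour P := fun Q x =>
  (∑' ω : Ω, S.seed ω * ∑' h : (∀ i, S.Record i),
    open Classical in
    if ∀ i, (S.protocolOn ω Q i).Produces (h i) (x i) then S.recordWeight h else 0).toReal

end NSStrategy

/-! ### Quantum players -/

/-- A quantum strategy: a shared density matrix on a tensor product of finite-dimensional spaces,
and for each player and input a two-outcome POVM. -/
structure QuantumStrategy (P : Type*) [Fintype P] [DecidableEq P] where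
  dim : P → ℕ
  state : Matrix (∀ i, Fin (dim i)) (∀ i, Fin (dim i)) ℂ
  state_posSemidef : state.PosSemidef
  state_trace : state.trace = 1
  effect : ∀ i : P, ℤ → Bool → Matrix (Fin (dim i)) (Fin (dim i)) ℂ
  effect_posSemidef : ∀ i a b, (effect i a b).PosSemidef
  effect_sum : ∀ i a, effect i a false + effect i a true = 1

namespace QuantumStrategy

variable {P : Type*} [Fintype P] [DecidableEq P]

/-- The effect of answer `b` for player `i`; a player who is not asked does not measure. -/
def effectOn (S : QuantumStrategy P) (Q : Question P) (i : P) (b : Bool) :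
    Matrix (Fin (S.dim i)) (Fin (S.dim i)) ℂ :=
  match Q i with
  | none => if b then 0 else 1
  | some a => S.effect i a b

/-- The tensor product of the effects of the players for the answers `x`. -/
def jointEffect (S : QuantumStrategy P) (Q : Question P) (x : P → Bool) :
    Matrix (∀ i, Fin (S.dim i)) (∀ i, Fin (S.dim i)) ℂ :=
  fun s t => ∏ i, S.effectOn Q i (x i) (s i) (t i)

/-- The Born rule: the trace of the state times the tensor product of the effects. -/
def behaviour (S : QuantumStrategy P) : Behaviour P := fun Q x =>
  (S.state * S.jointEffect Q x).trace.re

end QuantumStrategy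

/-- The quantum value of the `k`-extended chained Bell game. -/
def quantumValue (n k : ℕ) : ℝ :=
  sSup (Set.range fun S : QuantumStrategy (Player k) => winProb n k S.behaviour)

end ChainedBell

end

noncomputable section

namespace ChainedBell

/-! ### Execution of protocols -/

/-! Classical bound. Fix the shared randomness and order the players other than Bob as P₀ = Alice,
P₁, …, Pₖ = the Charlies. A resource with at most k+1 members that includes Bob misses some P_t.
Giving Bob a private copy of a resource that misses P_t cannot be noticed when only Bob and P_t are
asked (`cutBehaviour_congr`). Walk along the path, cutting Bob off at each step from the resources
that miss the current player. The triangle inequality for "the answers differ" moves the comparison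
from (Bob, P_t) to (Bob, P_{t+1}) at the price of the disagreement of P_t and P_{t+1} on input 0,
which the cuts do not affect because Bob is not asked there (`bobDist_cut_succ`). At Pₖ all
resources may be taken as cut (`bobDist_univ`), so the answers of Bob and Pₖ are independent.

Let v₀, v₁ be the probabilities that Bob answers `true` on inputs 0, 1, let w be that of Pₖ on input
0, and let e be the sum of the consistency losses. The walk gives v_b(1 - w) + (1 - v_b)w ≤ loss(0,
b) + 2e. The chained Bell inequality, run separately for the two values of the Charlies' parity,
gives |v₀ + v₁ - 1| ≤ L, where L is the loss over all a ≠ 0 (`bob_chain`). Adding the two estimates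
yields 1 ≤ total game loss + 4e (`one_le_loss`). The weights of the game put at least 4e on the
consistency questions, by Bernoulli's inequality 3^k ≥ 1 + 2k.

All this requires that adaptive executions of multi-round resources are non-signaling. A complete
record of a player is a path in a well-founded tree, and the weights are preserved when one more
query is summed over its output, so a player's records can be summed out (`tsum_produces`,
`execProb_eq_of_eqOn`). This holds for the weights with cuts as well.

Quantum bound. The players share a GHZ state. On input 0 Alice and the Charlies measure in the
computational basis and always agree. On input 1 the Charlies measure in the conjugate basis, and
their parity s leaves Alice and Bob with |00⟩ + (-1)^s |11⟩, up to normalization. Alice reflects her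
angle for a < 0, so that the standard chained Bell measurements work for the parity being tested.
Each link then loses (1 - cos(π/2n))/2 in total over the two signs (`gameLoss_ghz_chain`), and the
total game loss is below 5/(4n). -/

theorem ennreal_tsum_prod {α β : Type*} (f : α × β → ℝ≥0∞) :
    ∑' z, f z = ∑' a, ∑' b, f (a, b) :=
  ENNReal.tsum_prod (f := fun a b => f (a, b))

/-- `F` behaves like a martingale along the protocol tree. The tree is well-founded, so induction
applies for output alphabets of any size and no weight is lost to infinite runs. -/
theorem Protocol.tsum_produces {R I O : Type*} (π : Protocol R I O)
    (F : List (R × I × O) → ℝ≥0∞)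
    (hF : ∀ g r a, ∑' o, F (g ++ [(r, a, o)]) = F g) (g : List (R × I × O)) :
    (∑' y : Bool × List (R × I × O), open Classical in
      if π.Produces y.2 y.1 then F (g ++ y.2) else 0) = F g := by
  classical
  induction π generalizing g with
  | answer b =>
    rw [tsum_eq_single (b, [])]
    · simp [Protocol.Produces.answer]
    · rintro ⟨b', h⟩ hne
      rw [if_neg]
      rintro ⟨⟩
      exact hne rfl
  | query r a next ih =>
    rw [← hF g r a, ← tsum_congr fun o => ih o (g ++ [(r, a, o)]), ← ENNReal.tsum_prod]
    symm
    let φ : O × Bool × List (R × I × O) → Bool × List (R × I × O) :=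
      fun z => (z.2.1, (r, a, z.1) :: z.2.2)
    have hφ : Function.Injective φ := by
      rintro ⟨o, b, h⟩ ⟨o', b', h'⟩ hh
      simp only [φ, Prod.mk.injEq, List.cons.injEq] at hh
      aesop
    have := hφ.tsum_eq (f := fun y : Bool × List (R × I × O) =>
      if (Protocol.query r a next).Produces y.2 y.1 then F (g ++ y.2) else 0) (by
        rintro ⟨b, h⟩ hy
        have hp : (Protocol.query r a next).Produces h b := by
          by_contra hc
          exact hy (if_neg hc)
        cases hp with
        | query _ _ _ o h _ hp => exact ⟨(o, b, h), rfl⟩)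
    rw [← this]
    refine tsum_congr fun z => ?_
    have : (Protocol.query r a next).Produces (φ z).2 (φ z).1 ↔ (next z.1).Produces z.2.2 z.2.1 := by
      constructor
      · intro hp
        cases hp with
        | query _ _ _ o h _ hp => exact hp
      · exact Protocol.Produces.query _ _ _ _ _ _
    simp [this, φ]

section Execution

variable {P I O : Type*} [DecidableEq P] {R : P → Type*}

/-- Weights on the records of all players that sum up correctly over the output of any additional
query of any player. -/
structure IsCausal (G : (∀ i, List (R i × I × O)) → ℝ≥0∞) : Prop where
  nil : G (fun _ => []) = 1
  append : ∀ h i r a, ∑' o, G (Function.update h i (h i ++ [(r, a, o)])) = G h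

/-- The probability of an event for the answers of players following the protocols `π`. -/
def execProb (G : (∀ i, List (R i × I × O)) → ℝ≥0∞) (π : ∀ i, Protocol (R i) I O)
    (E : (P → Bool) → Prop) : ℝ≥0∞ :=
  open Classical in ∑' y : ∀ i, Bool × List (R i × I × O),
    if (∀ i, (π i).Produces (y i).2 (y i).1) ∧ E (fun i => (y i).1) then G (fun i => (y i).2) else 0

/-- No-signaling for executions: an event that ignores the answer of `i` allows the records of `i`
to be summed out first, and by `Protocol.tsum_produces` this leaves the weight in which `i` made no
query. -/
theorem execProb_eq_of_eqOn {G : (∀ i, List (R i × I × O)) → ℝ≥0∞} (hG : IsCausal G)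
    (i : P) {E : (P → Bool) → Prop} (hE : ∀ x b, E (Function.update x i b) ↔ E x)
    {π π' : ∀ i, Protocol (R i) I O} (h : ∀ j, j ≠ i → π j = π' j) :
    execProb G π E = execProb G π' E := by
  classical
  have key : ∀ π : ∀ i, Protocol (R i) I O, execProb G π E =
      ∑' y : (∀ j : {j // j ≠ i}, Bool × List (R j × I × O)),
        if (∀ j : {j // j ≠ i}, (π j).Produces (y j).2 (y j).1) ∧
          E (fun j => if hj : j = i then false else (y ⟨j, hj⟩).1) then
          G (fun j => if hj : j = i then [] else (y ⟨j, hj⟩).2) else 0 := by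
    intro π
    unfold execProb
    rw [← (Equiv.piSplitAt i (fun i => Bool × List (R i × I × O))).symm.tsum_eq,
      ennreal_tsum_prod, ENNReal.tsum_comm]
    refine tsum_congr fun y => ?_
    set x₀ : P → Bool := fun j => if hj : j = i then false else (y ⟨j, hj⟩).1 with hx₀
    set h₀ : ∀ j, List (R j × I × O) := fun j => if hj : j = i then [] else (y ⟨j, hj⟩).2 with hh₀
    have h1 : ∀ z, (fun j => ((Equiv.piSplitAt i
        (fun i => Bool × List (R i × I × O))).symm (z, y) j).1) = Function.update x₀ i z.1 := by
      intro z
      funext j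
      by_cases hj : j = i
      · subst hj; simp [Equiv.piSplitAt]
      · simp [Equiv.piSplitAt, hj, hx₀]
    have h2 : ∀ z, (fun j => ((Equiv.piSplitAt i
        (fun i => Bool × List (R i × I × O))).symm (z, y) j).2) = Function.update h₀ i z.2 := by
      intro z
      funext j
      by_cases hj : j = i
      · subst hj; simp [Equiv.piSplitAt]
      · simp [Equiv.piSplitAt, hj, hh₀]
    have h3 : ∀ z, (∀ j, (π j).Produces ((Equiv.piSplitAt i
        (fun i => Bool × List (R i × I × O))).symm (z, y) j).2 ((Equiv.piSplitAt i
        (fun i => Bool × List (R i × I × O))).symm (z, y) j).1) ↔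
        (π i).Produces z.2 z.1 ∧ ∀ j : {j // j ≠ i}, (π j).Produces (y j).2 (y j).1 := by
      intro z
      constructor
      · intro hh
        refine ⟨by simpa [Equiv.piSplitAt] using hh i, fun j => ?_⟩
        have := hh j
        simpa [Equiv.piSplitAt, j.2] using this
      · rintro ⟨ha, hb⟩ j
        by_cases hj : j = i
        · subst hj; simpa [Equiv.piSplitAt] using ha
        · simpa [Equiv.piSplitAt, hj] using hb ⟨j, hj⟩
    simp_rw [h1, h2, h3, hE]
    by_cases hc : (∀ j : {j // j ≠ i}, (π j).Produces (y j).2 (y j).1) ∧ E x₀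
    · rw [if_pos hc]
      have := (π i).tsum_produces (fun g => G (Function.update h₀ i g)) (by
        intro g r a
        have := hG.append (Function.update h₀ i g) i r a
        simpa using this) []
      have h0 : Function.update h₀ i [] = h₀ := by
        funext j
        by_cases hj : j = i
        · subst hj; simp [hh₀]
        · simp [hj]
      rw [h0] at this
      rw [← this]
      refine tsum_congr fun z => ?_
      simp [hc.1, hc.2]
    · rw [if_neg hc]
      simp only [ENNReal.tsum_eq_zero]
      intro z
      rw [if_neg]
      tauto
  rw [key, key]
  have : ∀ j : {j // j ≠ i}, π j = π' j := fun j => h j j.2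
  simp_rw [this]

theorem execProb_answer (G : (∀ i, List (R i × I × O)) → ℝ≥0∞) (hG : IsCausal G) :
    execProb G (fun _ => .answer false) (fun _ => True) = 1 := by
  classical
  unfold execProb
  rw [tsum_eq_single (fun _ => (false, []))]
  · simp [Protocol.Produces.answer, hG.nil]
  · intro y hy
    rw [if_neg]
    rintro ⟨h, -⟩
    apply hy
    funext i
    have := h i
    generalize y i = z at this
    obtain ⟨b, l⟩ := z
    cases this
    rfl

/-- The players are replaced one at a time by players who answer without any query. -/
theorem execProb_true [Fintype P] {G : (∀ i, List (R i × I × O)) → ℝ≥0∞} (hG : IsCausal G)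
    (π : ∀ i, Protocol (R i) I O) : execProb G π (fun _ => True) = 1 := by
  classical
  have : ∀ s : Finset P, execProb G π (fun _ => True) =
      execProb G (fun i => if i ∈ s then .answer false else π i) (fun _ => True) := by
    intro s
    induction s using Finset.induction_on with
    | empty => simp
    | insert i s hi ih =>
      rw [ih]
      refine execProb_eq_of_eqOn hG i (fun _ _ => Iff.rfl) fun j hj => ?_
      simp [hj]
  rw [this Finset.univ, ← execProb_answer G hG]
  simp

/-- The probability of a single tuple of answers. -/
def answerProb (G : (∀ i, List (R i × I × O)) → ℝ≥0∞) (π : ∀ i, Protocol (R i) I O)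
    (x : P → Bool) : ℝ≥0∞ :=
  open Classical in ∑' h : ∀ i, List (R i × I × O),
    if ∀ i, (π i).Produces (h i) (x i) then G h else 0

theorem sum_answerProb [Fintype P] (G : (∀ i, List (R i × I × O)) → ℝ≥0∞)
    (π : ∀ i, Protocol (R i) I O) (E : (P → Bool) → Prop) :
    (open Classical in ∑ x : P → Bool, if E x then answerProb G π x else 0) = execProb G π E := by
  classical
  let e : ((∀ _ : P, Bool) × ∀ i, List (R i × I × O)) ≃ ∀ i, Bool × List (R i × I × O) :=
    { toFun := fun z i => (z.1 i, z.2 i)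
      invFun := fun y => (fun i => (y i).1, fun i => (y i).2)
      left_inv := fun _ => rfl
      right_inv := fun _ => rfl }
  unfold execProb answerProb
  rw [← e.tsum_eq, ennreal_tsum_prod, tsum_fintype]
  refine Finset.sum_congr rfl fun x _ => ?_
  split_ifs with hx
  · simp only [e, Equiv.coe_fn_mk, hx, and_true]
    exact tsum_congr fun h => by congr
  · simp [hx, e]

/-- A behaviour in which an event that does not involve the answer of a player does not depend on
the input of this player either. -/
structure IsNonsignaling [Fintype P] (p : Behaviour P) : Prop where
  nonneg : ∀ Q x, 0 ≤ p Q x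
  total : ∀ Q, acceptProb p Q (fun _ => True) = 1
  congr : ∀ (Q Q' : Question P) (i : P) (E : (P → Bool) → Prop),
    (∀ x b, E (Function.update x i b) ↔ E x) → (∀ j, j ≠ i → Q j = Q' j) →
      acceptProb p Q E = acceptProb p Q' E

/-- The protocols used by the players on a question. -/
def protocolFor (π : ∀ i, ℤ → Protocol (R i) I O) (Q : Question P) (i : P) : Protocol (R i) I O :=
  match Q i with
  | none => .answer false
  | some a => π i a

/-- The behaviour of players following the protocols `π` with resources described by `G`. -/
def execBehaviour (G : (∀ i, List (R i × I × O)) → ℝ≥0∞) (π : ∀ i, ℤ → Protocol (R i) I O) :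
    Behaviour P := fun Q x => (answerProb G (protocolFor π Q) x).toReal

theorem answerProb_le_one [Fintype P] {G : (∀ i, List (R i × I × O)) → ℝ≥0∞} (hG : IsCausal G)
    (π : ∀ i, Protocol (R i) I O) (x : P → Bool) : answerProb G π x ≤ 1 := by
  classical
  rw [← execProb_true hG π, ← sum_answerProb]
  simpa using Finset.single_le_sum (f := fun x => answerProb G π x) (fun _ _ => zero_le)
    (Finset.mem_univ x)

theorem acceptProb_execBehaviour [Fintype P] {G : (∀ i, List (R i × I × O)) → ℝ≥0∞}
    (hG : IsCausal G) (π : ∀ i, ℤ → Protocol (R i) I O) (Q : Question P)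
    (E : (P → Bool) → Prop) :
    acceptProb (execBehaviour G π) Q E = (execProb G (protocolFor π Q) E).toReal := by
  classical
  rw [← sum_answerProb, ENNReal.toReal_sum]
  · unfold acceptProb execBehaviour
    refine Finset.sum_congr rfl fun x _ => ?_
    split_ifs <;> simp
  · intro x _
    split_ifs
    · exact ne_top_of_le_ne_top ENNReal.one_ne_top (answerProb_le_one hG _ x)
    · simp

theorem IsCausal.isNonsignaling [Fintype P] {G : (∀ i, List (R i × I × O)) → ℝ≥0∞}
    (hG : IsCausal G) (π : ∀ i, ℤ → Protocol (R i) I O) :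
    IsNonsignaling (execBehaviour G π) where
  nonneg _ _ := ENNReal.toReal_nonneg
  total Q := by simp [acceptProb_execBehaviour hG, execProb_true hG]
  congr Q Q' i E hE h := by
    rw [acceptProb_execBehaviour hG, acceptProb_execBehaviour hG]
    congr 1
    refine execProb_eq_of_eqOn hG i hE fun j hj => ?_
    simp [protocolFor, h j hj]

end Execution

/-! ### Weights of multi-round resources -/

namespace NSResource

variable {P I O : Type*}

theorem prob_nil (ρ : NSResource P I O) : ρ.prob (fun _ => []) (fun _ => []) = 1 := by
  rw [PMF.apply_eq_one_iff]
  apply Set.eq_singleton_iff_nonempty_unique_mem.2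
  refine ⟨(ρ.prob fun _ => []).support_nonempty, fun x hx => ?_⟩
  funext i
  simpa using ρ.length_eq _ x hx i

/-- This is the non-signaling condition with truncation to the lengths of `a`: the fibre of the
truncation over `x` consists of the extensions of `x i` by one output. -/
theorem tsum_prob_append [DecidableEq P] (ρ : NSResource P I O) (a : ρ.members → List I)
    (x : ρ.members → List O) (hx : ∀ i, (x i).length = (a i).length) (i : ρ.members) (α : I) :
    ∑' o, ρ.prob (Function.update a i (a i ++ [α])) (Function.update x i (x i ++ [o])) =
      ρ.prob a x := by
  classical
  have h := ρ.nonsignaling (Function.update a i (a i ++ [α])) (fun j => (a j).length)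
  have ha : (fun j => (Function.update a i (a i ++ [α]) j).take (a j).length) = a := by
    funext j
    by_cases hj : j = i
    · subst hj; simp
    · simp [hj]
  rw [ha] at h
  rw [← h, PMF.map_apply]
  let φ : O → ρ.members → List O := fun o => Function.update x i (x i ++ [o])
  have hφ : Function.Injective φ := by
    intro o o' ho
    have := congrFun ho i
    simpa [φ] using this
  have := hφ.tsum_eq (f := fun y => if x = fun j => (y j).take (a j).length then
      ρ.prob (Function.update a i (a i ++ [α])) y else 0) (by
    intro y hy
    rw [Function.mem_support, ne_eq, ite_eq_right_iff, not_forall] at hy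
    obtain ⟨h1, h2⟩ := hy
    have hl := ρ.length_eq _ y ((PMF.mem_support_iff _ _).2 h2)
    have hli := hl i
    simp only [Function.update_self, List.length_append, List.length_singleton] at hli
    have hne : y i ≠ [] := by
      intro h0
      simp [h0] at hli
    refine ⟨(y i).getLast hne, ?_⟩
    funext j
    by_cases hj : j = i
    · subst hj
      simp only [φ, Function.update_self]
      rw [congrFun h1 j]
      refine Eq.trans ?_ (List.dropLast_append_getLast hne)
      rw [List.dropLast_eq_take, hli, Nat.add_sub_cancel]
    · simp only [φ, ne_eq, hj, not_false_eq_true, Function.update_of_ne]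
      rw [congrFun h1 j, List.take_of_length_le]
      have := hl j
      simp only [ne_eq, hj, not_false_eq_true, Function.update_of_ne] at this
      omega)
  refine (tsum_congr fun o => ?_).trans (this.trans (tsum_congr fun y => by congr))
  rw [if_pos]
  funext j
  by_cases hj : j = i
  · subst hj; simp [φ, ← hx]
  · simp [φ, hj, ← hx]

end NSResource

theorem Protocol.Produces.eq_nil {R I O : Type*}
    {h : List (R × I × O)} {b b' : Bool} (hp : (Protocol.answer b').Produces h b) : h = [] := by
  cases hp; rfl

/-! ### Record weights of a network of resources, and cutting a player off -/

namespace NSStrategy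

variable {P : Type*} {m : ℕ} {I O Ω : Type*}

/-- The probability that a single resource gives the recorded outputs on the recorded inputs. -/
def factor (S : NSStrategy P m I O Ω) (r : Fin m) (h : ∀ i, S.Record i) : ℝ≥0∞ :=
  (S.resource r).prob
    (fun i => ((h i).filter fun e => e.1.val = r).map fun e => e.2.1)
    (fun i => ((h i).filter fun e => e.1.val = r).map fun e => e.2.2)

/-- Functions of the records that behave like the contribution of the resource `r`. -/
structure IsCausalFor [DecidableEq P] (S : NSStrategy P m I O Ω) (r : Fin m)
    (g : (∀ i, S.Record i) → ℝ≥0∞) : Prop where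
  nil : g (fun _ => []) = 1
  own : ∀ h i (hi : i ∈ (S.resource r).members) a,
    ∑' o, g (Function.update h i (h i ++ [(⟨r, hi⟩, a, o)])) = g h
  other : ∀ h i r' a o, r'.val ≠ r → g (Function.update h i (h i ++ [(r', a, o)])) = g h

theorem factor_eq_one (S : NSStrategy P m I O Ω) {r : Fin m} {h : ∀ i, S.Record i}
    (hh : ∀ i ∈ (S.resource r).members, h i = []) : S.factor r h = 1 := by
  rw [← (S.resource r).prob_nil]
  unfold factor
  congr 1
  · congr 1
    funext i
    simp [hh i i.2]
  · funext i
    simp [hh i i.2]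

theorem factor_congr (S : NSStrategy P m I O Ω) {r : Fin m} {h h' : ∀ i, S.Record i}
    (hh : ∀ i ∈ (S.resource r).members, h i = h' i) : S.factor r h = S.factor r h' := by
  unfold factor
  congr 1
  · congr 1
    funext i
    simp [hh i i.2]
  · funext i
    simp [hh i i.2]

variable [DecidableEq P]

theorem isCausalFor_factor (S : NSStrategy P m I O Ω) (r : Fin m) :
    S.IsCausalFor r (S.factor r) where
  nil := by simp [factor, NSResource.prob_nil]
  own h i hi a := by
    unfold factor
    rw [← NSResource.tsum_prob_append _ _ _ (by simp) ⟨i, hi⟩ a]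
    refine tsum_congr fun o => ?_
    congr 1
    · congr 1
      funext j
      by_cases hj : j = ⟨i, hi⟩
      · subst hj; simp
      · have : j.1 ≠ i := fun hh => hj (Subtype.ext hh)
        simp [hj, this]
    · funext j
      by_cases hj : j = ⟨i, hi⟩
      · subst hj; simp
      · have : j.1 ≠ i := fun hh => hj (Subtype.ext hh)
        simp [hj, this]
  other h i r' a o hr := by
    have : ∀ j, (Function.update h i (h i ++ [(r', a, o)]) j).filter (fun e => e.1.val = r) =
        (h j).filter (fun e => e.1.val = r) := by
      intro j
      by_cases hj : j = i
      · subst hj; simp [hr]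
      · simp [hj]
    simp only [factor, this]

/-- Erase the records of all players outside of a set. -/
def restrictRecord (S : NSStrategy P m I O Ω) (s : Set P) (h : ∀ i, S.Record i) (i : P) :
    S.Record i :=
  open Classical in if i ∈ s then h i else []

theorem restrictRecord_update_mem (S : NSStrategy P m I O Ω) {s : Set P} (h : ∀ i, S.Record i)
    {i : P} (hi : i ∈ s) (g : S.Record i) :
    S.restrictRecord s (Function.update h i (h i ++ g)) =
      Function.update (S.restrictRecord s h) i (S.restrictRecord s h i ++ g) := by
  funext j
  by_cases hj : j = i
  · subst hj; simp [restrictRecord, hi]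
  · simp [restrictRecord, hj]

theorem restrictRecord_update_notMem (S : NSStrategy P m I O Ω) {s : Set P}
    (h : ∀ i, S.Record i) {i : P} (hi : i ∉ s) (g : S.Record i) :
    S.restrictRecord s (Function.update h i g) = S.restrictRecord s h := by
  funext j
  by_cases hj : j = i
  · subst hj; simp [restrictRecord, hi]
  · simp [restrictRecord, hj]

/-- Two independent copies, one for `s` and one for its complement: each query reaches only one of
the two factors. -/
theorem IsCausalFor.mul_restrict {S : NSStrategy P m I O Ω} {r : Fin m}
    {g : (∀ i, S.Record i) → ℝ≥0∞} (hg : S.IsCausalFor r g) (s : Set P) :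
    S.IsCausalFor r (fun h => g (S.restrictRecord s h) * g (S.restrictRecord sᶜ h)) where
  nil := by
    have : ∀ s, S.restrictRecord s (fun _ => []) = fun _ => [] := by
      intro s; funext i; simp [restrictRecord]
    simp [this, hg.nil]
  own h i hi a := by
    by_cases his : i ∈ s
    · have hic : i ∉ sᶜ := by simpa using his
      simp_rw [restrictRecord_update_notMem S h hic, restrictRecord_update_mem S h his]
      rw [ENNReal.tsum_mul_right, hg.own]
    · have hic : i ∈ sᶜ := his
      simp_rw [restrictRecord_update_notMem S h his, restrictRecord_update_mem S h hic]
      rw [ENNReal.tsum_mul_left, hg.own]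
  other h i r' a o hr := by
    by_cases his : i ∈ s
    · have hic : i ∉ sᶜ := by simpa using his
      rw [restrictRecord_update_notMem S h hic, restrictRecord_update_mem S h his, hg.other _ _ _ _ _ hr]
    · have hic : i ∈ sᶜ := his
      rw [restrictRecord_update_notMem S h his, restrictRecord_update_mem S h hic, hg.other _ _ _ _ _ hr]

theorem isCausal_prod {S : NSStrategy P m I O Ω} {g : Fin m → (∀ i, S.Record i) → ℝ≥0∞}
    (hg : ∀ r, S.IsCausalFor r (g r)) : IsCausal (fun h => ∏ r, g r h) where
  nil := by simp [(hg _).nil]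
  append h i r a := by
    obtain ⟨r, hr⟩ := r
    rw [← Finset.mul_prod_erase _ _ (Finset.mem_univ r), ← (hg r).own h i hr a,
      ← ENNReal.tsum_mul_right]
    refine tsum_congr fun o => ?_
    rw [← Finset.mul_prod_erase _ _ (Finset.mem_univ r)]
    congr 1
    refine Finset.prod_congr rfl fun r' hr' => ?_
    exact (hg r').other _ _ _ _ _ (Finset.ne_of_mem_erase hr').symm

/-- The weight of the records in the network in which the player `i₀` uses separate copies of the
resources in `K`. -/
def cutWeight (S : NSStrategy P m I O Ω) (i₀ : P) (K : Set (Fin m)) (h : ∀ i, S.Record i) :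
    ℝ≥0∞ :=
  open Classical in ∏ r, if r ∈ K then
    S.factor r (S.restrictRecord {i₀} h) * S.factor r (S.restrictRecord {i₀}ᶜ h) else S.factor r h

theorem isCausal_cutWeight (S : NSStrategy P m I O Ω) (i₀ : P) (K : Set (Fin m)) :
    IsCausal (S.cutWeight i₀ K) := by
  classical
  unfold cutWeight
  refine isCausal_prod (g := fun r h => if r ∈ K then
    S.factor r (S.restrictRecord {i₀} h) * S.factor r (S.restrictRecord {i₀}ᶜ h)
    else S.factor r h) fun r => ?_
  by_cases hr : r ∈ K
  · simpa only [hr, if_true] using (S.isCausalFor_factor r).mul_restrict {i₀}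
  · simpa only [hr, if_false] using S.isCausalFor_factor r

omit [DecidableEq P] in
theorem cutWeight_empty (S : NSStrategy P m I O Ω) (i₀ : P) :
    S.cutWeight i₀ ∅ = S.recordWeight := by
  funext h
  simp [cutWeight, recordWeight, factor]

/-- Cutting the player `i₀` off from a resource does not matter if either this player or all
other members of the resource do not use it. -/
theorem factor_mul_restrict (S : NSStrategy P m I O Ω) {r : Fin m} {h : ∀ i, S.Record i} {i₀ : P}
    (hh : (i₀ ∈ (S.resource r).members → h i₀ = []) ∨
      ∀ i ∈ (S.resource r).members, i ≠ i₀ → h i = []) :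
    S.factor r (S.restrictRecord {i₀} h) * S.factor r (S.restrictRecord {i₀}ᶜ h) =
      S.factor r h := by
  rcases hh with hh | hh
  · rw [S.factor_eq_one, one_mul]
    · refine S.factor_congr fun i hi => ?_
      by_cases h0 : i = i₀
      · subst h0; simp [restrictRecord, hh hi]
      · simp [restrictRecord, h0]
    · intro i hi
      by_cases h0 : i = i₀
      · subst h0; simp [restrictRecord, hh hi]
      · simp [restrictRecord, h0]
  · rw [mul_comm, S.factor_eq_one, one_mul]
    · refine S.factor_congr fun i hi => ?_
      by_cases h0 : i = i₀
      · subst h0; simp [restrictRecord]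
      · simp [restrictRecord, h0, hh i hi h0]
    · intro i hi
      by_cases h0 : i = i₀
      · subst h0; simp [restrictRecord]
      · simp [restrictRecord, h0, hh i hi h0]

/-- The behaviour, given the shared randomness, when `i₀` uses separate copies of the resources
in `K`. -/
def cutBehaviour (S : NSStrategy P m I O Ω) (ω : Ω) (i₀ : P) (K : Set (Fin m)) : Behaviour P :=
  execBehaviour (S.cutWeight i₀ K) (S.protocol ω)

theorem isNonsignaling_cutBehaviour [Fintype P] (S : NSStrategy P m I O Ω) (ω : Ω) (i₀ : P)
    (K : Set (Fin m)) : IsNonsignaling (S.cutBehaviour ω i₀ K) :=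
  (S.isCausal_cutWeight i₀ K).isNonsignaling _

/-- A player who is not asked has an empty record, so a cut between `i₀` and the other members is
invisible unless both sides are active. -/
theorem cutBehaviour_congr (S : NSStrategy P m I O Ω) (ω : Ω) {i₀ : P} {K K' : Set (Fin m)}
    {Q : Question P}
    (hQ : ∀ r, (r ∈ K ↔ r ∈ K') ∨ (i₀ ∈ (S.resource r).members → Q i₀ = none) ∨
      ∀ i ∈ (S.resource r).members, i ≠ i₀ → Q i = none) :
    S.cutBehaviour ω i₀ K Q = S.cutBehaviour ω i₀ K' Q := by
  classical
  funext x
  unfold cutBehaviour execBehaviour answerProb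
  congr 1
  refine tsum_congr fun h => ?_
  split_ifs with hp
  · have hnil : ∀ i, Q i = none → h i = [] := by
      intro i hi
      have := hp i
      simp only [protocolFor, hi] at this
      exact this.eq_nil
    unfold cutWeight
    refine Finset.prod_congr rfl fun r _ => ?_
    rcases hQ r with hr | hr
    · simp [hr]
    · rw [S.factor_mul_restrict, ite_self, ite_self]
      exact hr.imp (fun h1 h2 => hnil _ (h1 h2)) fun h1 i hi h2 => hnil _ (h1 i hi h2)
  · rfl

/-- If `i₀` shares no resources with the others, the answers of this player are independent. -/
theorem exists_cutBehaviour_univ_eq_mul [Fintype P] (S : NSStrategy P m I O Ω) (ω : Ω) (i₀ : P)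
    (Q : Question P) : ∃ (u : Bool → ℝ) (v : (P → Bool) → ℝ),
      ∀ x, S.cutBehaviour ω i₀ Set.univ Q x = u (x i₀) * v (Function.update x i₀ false) := by
  classical
  refine ⟨fun b => (∑' h : S.Record i₀, if (protocolFor (S.protocol ω) Q i₀).Produces h b then
      ∏ r, S.factor r (Function.update (fun _ => [] : ∀ i, S.Record i) i₀ h) else 0).toReal,
    fun x => (∑' h : ∀ j : {j // j ≠ i₀}, S.Record j,
      if (∀ j : {j // j ≠ i₀}, (protocolFor (S.protocol ω) Q j).Produces (h j) (x j)) then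
      ∏ r, S.factor r (fun j => if hj : j = i₀ then [] else h ⟨j, hj⟩) else 0).toReal,
    fun x => ?_⟩
  unfold cutBehaviour execBehaviour answerProb
  rw [← ENNReal.toReal_mul]
  congr 1
  rw [← (Equiv.piSplitAt i₀ S.Record).symm.tsum_eq, ennreal_tsum_prod, ← ENNReal.tsum_mul_right]
  refine tsum_congr fun h => ?_
  rw [← ENNReal.tsum_mul_left]
  refine tsum_congr fun h' => ?_
  have h1 : S.restrictRecord {i₀} ((Equiv.piSplitAt i₀ S.Record).symm (h, h')) =
      Function.update (fun _ => [] : ∀ i, S.Record i) i₀ h := by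
    funext j
    by_cases hj : j = i₀
    · subst hj; simp [restrictRecord, Equiv.piSplitAt]
    · simp [restrictRecord, hj]
  have h2 : S.restrictRecord {i₀}ᶜ ((Equiv.piSplitAt i₀ S.Record).symm (h, h')) =
      fun j => if hj : j = i₀ then [] else h' ⟨j, hj⟩ := by
    funext j
    by_cases hj : j = i₀
    · subst hj; simp [restrictRecord]
    · simp [restrictRecord, hj, Equiv.piSplitAt]
  have h3 : (∀ i, (protocolFor (S.protocol ω) Q i).Produces
      ((Equiv.piSplitAt i₀ S.Record).symm (h, h') i) (x i)) ↔
      (protocolFor (S.protocol ω) Q i₀).Produces h (x i₀) ∧ ∀ j : {j // j ≠ i₀},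
        (protocolFor (S.protocol ω) Q j).Produces (h' j) (Function.update x i₀ false j) := by
    constructor
    · intro hh
      refine ⟨by simpa [Equiv.piSplitAt] using hh i₀, fun j => ?_⟩
      have := hh j
      simpa [Equiv.piSplitAt, j.2] using this
    · rintro ⟨ha, hb⟩ j
      by_cases hj : j = i₀
      · subst hj; simpa [Equiv.piSplitAt] using ha
      · simpa [Equiv.piSplitAt, hj] using hb ⟨j, hj⟩
  -- With every resource cut, the weight is a function of the record of `i₀` times a function of the
  -- other records.
  unfold cutWeight
  simp only [Set.mem_univ, if_true, h1, h2, h3, Finset.prod_mul_distrib]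
  rw [ite_zero_mul_ite_zero]

theorem hasSum_cutBehaviour [Fintype P] (S : NSStrategy P m I O Ω) (i₀ : P) (Q : Question P)
    (x : P → Bool) :
    HasSum (fun ω => (S.seed ω).toReal * S.cutBehaviour ω i₀ ∅ Q x) (S.behaviour Q x) := by
  classical
  have hb : S.behaviour Q x = (∑' ω, S.seed ω *
      answerProb (S.cutWeight i₀ ∅) (protocolFor (S.protocol ω) Q) x).toReal := by
    rw [cutWeight_empty]
    rfl
  have hle : ∑' ω, S.seed ω *
      answerProb (S.cutWeight i₀ ∅) (protocolFor (S.protocol ω) Q) x ≤ 1 := by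
    rw [← S.seed.tsum_coe]
    exact ENNReal.tsum_le_tsum fun ω =>
      mul_le_of_le_one_right' (answerProb_le_one (S.isCausal_cutWeight i₀ ∅) _ x)
  have hne := ne_top_of_le_ne_top ENNReal.one_ne_top hle
  rw [hb, ENNReal.tsum_toReal_eq (fun ω => ENNReal.ne_top_of_tsum_ne_top hne ω)]
  have := ENNReal.summable_toReal hne
  convert this.hasSum using 1
  · funext ω
    simp [cutBehaviour, execBehaviour]

end NSStrategy

/-! ### Nonsignaling behaviours -/

section Nonsignaling

variable {P : Type*} [Fintype P] [DecidableEq P] {p : Behaviour P} {Q Q' : Question P}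

theorem acceptProb_congr {E E' : (P → Bool) → Prop} (h : ∀ x, E x ↔ E' x) :
    acceptProb p Q E = acceptProb p Q E' := by
  rw [funext fun x => propext (h x)]

theorem acceptProb_eq_sum_filter (E : (P → Bool) → Prop) [DecidablePred E] :
    acceptProb p Q E = ∑ x with E x, p Q x := by
  rw [Finset.sum_filter]
  unfold acceptProb
  exact Finset.sum_congr rfl fun x _ => by congr

theorem acceptProb_split (E F : (P → Bool) → Prop) :
    acceptProb p Q E = acceptProb p Q (fun x => E x ∧ F x) +
      acceptProb p Q (fun x => E x ∧ ¬ F x) := by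
  classical
  unfold acceptProb
  rw [← Finset.sum_add_distrib]
  refine Finset.sum_congr rfl fun x _ => ?_
  by_cases h1 : E x <;> by_cases h2 : F x <;> simp [h1, h2]

namespace IsNonsignaling

variable (hp : IsNonsignaling p)
include hp

theorem acceptProb_nonneg (E : (P → Bool) → Prop) : 0 ≤ acceptProb p Q E := by
  unfold acceptProb
  refine Finset.sum_nonneg fun x _ => ?_
  split_ifs
  · exact hp.nonneg Q x
  · exact le_rfl

theorem acceptProb_mono {E E' : (P → Bool) → Prop} (h : ∀ x, E x → E' x) :
    acceptProb p Q E ≤ acceptProb p Q E' := by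
  unfold acceptProb
  refine Finset.sum_le_sum fun x _ => ?_
  by_cases h1 : E x
  · simp [h1, h x h1]
  · simp only [h1, if_false]
    split_ifs
    · exact hp.nonneg Q x
    · exact le_rfl

theorem acceptProb_le_add {E F G : (P → Bool) → Prop} (h : ∀ x, E x → F x ∨ G x) :
    acceptProb p Q E ≤ acceptProb p Q F + acceptProb p Q G := by
  rw [acceptProb_split E F]
  gcongr
  · exact hp.acceptProb_mono fun x hx => hx.2
  · exact hp.acceptProb_mono fun x hx => (h x hx.1).resolve_left hx.2

theorem acceptProb_not (E : (P → Bool) → Prop) :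
    acceptProb p Q (fun x => ¬ E x) = 1 - acceptProb p Q E := by
  have := acceptProb_split (p := p) (Q := Q) (fun _ => True) E
  rw [hp.total] at this
  simp only [true_and] at this
  linarith

/-- The inputs outside `T` are exchanged one player at a time. -/
theorem acceptProb_congr_on (T : Finset P) {E : (P → Bool) → Prop}
    (hE : ∀ x x', (∀ i ∈ T, x i = x' i) → E x → E x') (hQ : ∀ i ∈ T, Q i = Q' i) :
    acceptProb p Q E = acceptProb p Q' E := by
  classical
  have : ∀ s : Finset P, Disjoint s T → acceptProb p Q E =
      acceptProb p (fun i => if i ∈ s then Q' i else Q i) E := by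
    intro s
    induction s using Finset.induction_on with
    | empty => simp
    | insert i s hi ih =>
      intro hs
      rw [Finset.disjoint_insert_left] at hs
      rw [ih hs.2]
      refine hp.congr _ _ i _ (fun x b => ?_) fun j hj => by simp [hj]
      constructor
      · refine hE _ _ fun j hj => ?_
        rw [Function.update_of_ne]
        rintro rfl
        exact hs.1 hj
      · refine hE _ _ fun j hj => ?_
        rw [Function.update_of_ne]
        rintro rfl
        exact hs.1 hj
  rw [this Tᶜ disjoint_compl_left]
  congr 1
  funext i
  by_cases hi : i ∈ T
  · simp [hi, hQ i hi]
  · simp [hi]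

/-- Answers of a player whose behaviour factors out are independent of the other answers. -/
theorem acceptProb_ne_of_factor {i l : P} (hil : l ≠ i) {u : Bool → ℝ} {v : (P → Bool) → ℝ}
    (huv : ∀ x, p Q x = u (x i) * v (Function.update x i false)) :
    acceptProb p Q (fun x => x i ≠ x l) =
      acceptProb p Q (fun x => x i = true) * (1 - acceptProb p Q (fun x => x l = true)) +
      (1 - acceptProb p Q (fun x => x i = true)) * acceptProb p Q (fun x => x l = true) := by
  classical
  let V : ((P → Bool) → Prop) → ℝ := fun E =>
    acceptProb (fun _ => v) Q (fun x => x i = false ∧ E x)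
  have h1 : ∀ (s : Bool) (E : (P → Bool) → Prop), (∀ x b, E (Function.update x i b) ↔ E x) →
      acceptProb p Q (fun x => x i = s ∧ E x) = u s * V E := by
    intro s E hE
    simp only [V, acceptProb_eq_sum_filter, Finset.mul_sum]
    refine Finset.sum_bij' (fun x _ => Function.update x i false)
      (fun x _ => Function.update x i s) ?_ ?_ ?_ ?_ ?_
    · intro x hx
      simp only [Finset.mem_filter, Finset.mem_univ, true_and] at hx ⊢
      simp [hE, hx.2]
    · intro x hx
      simp only [Finset.mem_filter, Finset.mem_univ, true_and] at hx ⊢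
      simp [hE, hx.2]
    · intro x hx
      simp only [Finset.mem_filter, Finset.mem_univ, true_and] at hx
      simp [← hx.1]
    · intro x hx
      simp only [Finset.mem_filter, Finset.mem_univ, true_and] at hx
      simp [← hx.1]
    · intro x hx
      simp only [Finset.mem_filter, Finset.mem_univ, true_and] at hx
      rw [huv, hx.1]
  have h2 : ∀ E : (P → Bool) → Prop, (∀ x b, E (Function.update x i b) ↔ E x) →
      acceptProb p Q E = (u true + u false) * V E := by
    intro E hE
    rw [acceptProb_split E (fun x => x i = true), add_mul, ← h1 true E hE, ← h1 false E hE]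
    congr 1
    · exact acceptProb_congr fun x => and_comm
    · exact acceptProb_congr fun x => by simp [and_comm]
  have hT := h2 (fun _ => True) (fun _ _ => Iff.rfl)
  rw [hp.total] at hT
  have hi : acceptProb p Q (fun x => x i = true) = u true * V (fun _ => True) := by
    rw [← h1 true _ (fun _ _ => Iff.rfl)]
    exact acceptProb_congr fun x => by simp
  have hE : ∀ (t : Bool) (x : P → Bool) (b : Bool), Function.update x i b l = t ↔ x l = t := by
    intro t x b
    rw [Function.update_of_ne hil]
  have hl := h2 (fun x => x l = true) (hE true)
  have hl' := h2 (fun x => x l = false) (hE false)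
  have hsum : acceptProb p Q (fun x => x l = false) = 1 - acceptProb p Q (fun x => x l = true) := by
    rw [← hp.acceptProb_not]
    exact acceptProb_congr fun x => by simp
  rw [← hsum, acceptProb_split _ (fun x => x i = true)]
  have e1 : acceptProb p Q (fun x => x i ≠ x l ∧ x i = true) =
      u true * V (fun x => x l = false) := by
    rw [← h1 true _ (hE false)]
    refine acceptProb_congr fun x => ?_
    cases x i <;> cases x l <;> simp
  have e2 : acceptProb p Q (fun x => x i ≠ x l ∧ ¬ x i = true) =
      u false * V (fun x => x l = true) := by
    rw [← h1 false _ (hE true)]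
    refine acceptProb_congr fun x => ?_
    cases x i <;> cases x l <;> simp
  rw [e1, e2, hl, hl', hi]
  -- Neither `u` nor `v` need be normalized; only `hT`, the total probability, fixes their product.
  linear_combination (u true * V (fun x => x l = false) - u true * V (fun x => x l = true)) * hT

end IsNonsignaling

end Nonsignaling

/-! ### The chained Bell inequality -/

section Chain

variable {k : ℕ} {p : Behaviour (Player k)}

/-- The probability of losing on a game question. -/
def gameLoss (n : ℕ) (p : Behaviour (Player k)) (a b : ℤ) : ℝ :=
  acceptProb p (gameQuestion a b) (fun x => ¬ GameAccept n a b x)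

/-- The probability of losing on a consistency question. -/
def consistencyLoss (p : Behaviour (Player k)) (j : Fin k) : ℝ :=
  acceptProb p (consistencyQuestion j) (fun x => ¬ ConsistencyAccept j x)

/-- The question that sends the input `b` to Bob and `1` to the Charlies. -/
def bobQuestion (b : ℤ) : Question (Player k)
  | .alice => none
  | .bob => some b
  | .charlie _ => some 1

/-- The question that sends the input `a` to Alice and `1` to the Charlies. -/
def aliceQuestion (a : ℤ) : Question (Player k)
  | .alice => some a
  | .bob => none
  | .charlie _ => some 1

theorem charlieParity_congr {x x' : Player k → Bool} (h : ∀ j, x (.charlie j) = x' (.charlie j)) :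
    charlieParity x = charlieParity x' := by
  simp [charlieParity, h]

namespace IsNonsignaling

variable (hp : IsNonsignaling p)
include hp

/-- All nonzero `a` send the same input to the Charlies, so the joint law of Bob's answer and the
parity is common to them. This lets the links of the chain be joined. -/
theorem acceptProb_bob_eq {a : ℤ} (ha : a ≠ 0) (b : ℤ) (t s : Bool) :
    acceptProb p (bobQuestion b) (fun x => x .bob = t ∧ charlieParity x = s) =
      acceptProb p (gameQuestion a b) (fun x => x .bob = t ∧ charlieParity x = s) := by
  refine hp.congr _ _ .alice _ (fun x c => ?_) fun j hj => ?_
  · rw [charlieParity_congr (x := Function.update x .alice c) (x' := x) (by simp)]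
    simp
  · cases j <;> simp_all [bobQuestion, gameQuestion]

theorem acceptProb_alice_eq {a : ℤ} (ha : a ≠ 0) (b : ℤ) (t s : Bool) :
    acceptProb p (aliceQuestion a) (fun x => x .alice = t ∧ charlieParity x = s) =
      acceptProb p (gameQuestion a b) (fun x => x .alice = t ∧ charlieParity x = s) := by
  refine hp.congr _ _ .bob _ (fun x c => ?_) fun j hj => ?_
  · rw [charlieParity_congr (x := Function.update x .bob c) (x' := x) (by simp)]
    simp
  · cases j <;> simp_all [aliceQuestion, gameQuestion]

theorem bob_le_alice (n : ℕ) {a : ℤ} (ha : a ≠ 0) (b : ℤ) {t t' : Bool}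
    (h : if |a| = (n : ℤ) - 1 ∧ b = (n : ℤ) - 1 then t' ≠ t else t' = t) :
    acceptProb p (bobQuestion b) (fun x => x .bob = t ∧ charlieParity x = decide (a < 0)) ≤
      acceptProb p (aliceQuestion a) (fun x => x .alice = t' ∧ charlieParity x = decide (a < 0)) +
        gameLoss n p a b := by
  rw [hp.acceptProb_bob_eq ha, hp.acceptProb_alice_eq ha b]
  refine hp.acceptProb_le_add fun x => ?_
  simp only [GameAccept, ha, false_and, ne_eq, not_false_eq_true, true_and, false_or]
  rintro ⟨h1, h2⟩
  split_ifs at h ⊢ <;> simp only [h1, h2, not_true_eq_false, false_or, true_and, and_true] <;>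
    generalize x .alice = y <;> revert h <;> clear h1 h2 <;> revert t t' y <;> decide

theorem alice_le_bob (n : ℕ) {a : ℤ} (ha : a ≠ 0) (b : ℤ) {t t' : Bool}
    (h : if |a| = (n : ℤ) - 1 ∧ b = (n : ℤ) - 1 then t' ≠ t else t' = t) :
    acceptProb p (aliceQuestion a) (fun x => x .alice = t ∧ charlieParity x = decide (a < 0)) ≤
      acceptProb p (bobQuestion b) (fun x => x .bob = t' ∧ charlieParity x = decide (a < 0)) +
        gameLoss n p a b := by
  rw [hp.acceptProb_bob_eq ha, hp.acceptProb_alice_eq ha b]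
  refine hp.acceptProb_le_add fun x => ?_
  simp only [GameAccept, ha, false_and, ne_eq, not_false_eq_true, true_and, false_or]
  rintro ⟨h1, h2⟩
  split_ifs at h ⊢ <;> simp only [h1, h2, not_true_eq_false, false_or, true_and, and_true] <;>
    generalize x .bob = y <;> revert h <;> clear h1 h2 <;> revert t t' y <;> decide

/-- The chain of inequalities for one value of the parity of the Charlies. -/
theorem bob_chain_of_sign {n : ℕ} (hn : 2 ≤ n) {σ : ℤ} (hσ : σ = 1 ∨ σ = -1) (t : Bool) :
    acceptProb p (bobQuestion 1) (fun x => x .bob = t ∧ charlieParity x = decide (σ < 0)) ≤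
      acceptProb p (bobQuestion 0) (fun x => x .bob = !t ∧ charlieParity x = decide (σ < 0)) +
      ∑ c ∈ Finset.Ico 1 n, (gameLoss n p (σ * (c : ℤ)) (c : ℤ) +
        gameLoss n p (σ * (c : ℤ)) (((c : ℤ) + 1) % n)) := by
  have hsign : ∀ c : ℕ, 1 ≤ c → (σ * (c : ℤ) < 0 ↔ σ < 0) := by
    intro c hc
    rcases hσ with rfl | rfl <;> constructor <;> intro h <;> omega
  have hne : ∀ c : ℕ, 1 ≤ c → σ * (c : ℤ) ≠ 0 := by
    intro c hc
    rcases hσ with rfl | rfl <;> omega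
  have habs : ∀ c : ℕ, |σ * (c : ℤ)| = c := by
    intro c
    rcases hσ with rfl | rfl <;> simp
  have key : ∀ c : ℕ, 1 ≤ c → c < n →
      acceptProb p (bobQuestion 1) (fun x => x .bob = t ∧ charlieParity x = decide (σ < 0)) ≤
      acceptProb p (bobQuestion c) (fun x => x .bob = t ∧ charlieParity x = decide (σ < 0)) +
      ∑ c ∈ Finset.Ico 1 c, (gameLoss n p (σ * (c : ℤ)) (c : ℤ) +
        gameLoss n p (σ * (c : ℤ)) (((c : ℤ) + 1) % n)) := by
    intro c hc
    induction c, hc using Nat.le_induction with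
    | base => intro _; simp
    | succ c hc ih =>
      intro hcn
      have hmod : ((c : ℤ) + 1) % n = ((c + 1 : ℕ) : ℤ) := by
        rw [Int.emod_eq_of_lt] <;> push_cast <;> omega
      have h1 := hp.bob_le_alice n (hne c hc) (c : ℤ) (t := t) (t' := t) (by
        rw [if_neg]; omega)
      have h2 := hp.alice_le_bob n (hne c hc) (((c : ℤ) + 1) % n) (t := t) (t' := t) (by
        rw [if_neg]; rw [habs]; omega)
      simp only [hsign c hc] at h1 h2
      rw [Finset.sum_Ico_succ_top hc]
      have := ih (by omega)
      rw [hmod] at h2 ⊢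
      linarith
  -- The last link, at |a| = n - 1, returns to Bob's input 0 and is the only one with a flip, whence
  -- `!t`.
  obtain ⟨c, rfl⟩ : ∃ c, n = c + 1 := ⟨n - 1, by omega⟩
  have hc : 1 ≤ c := by omega
  have h0 := key c hc (by omega)
  have hmod : ((c : ℤ) + 1) % ((c + 1 : ℕ) : ℤ) = 0 := by push_cast; simp
  have h1 := hp.bob_le_alice (c + 1) (hne c hc) (c : ℤ) (t := t) (t' := !t) (by
    rw [if_pos]
    · simp
    · rw [habs]; push_cast; omega)
  have h2 := hp.alice_le_bob (c + 1) (hne c hc) 0 (t := !t) (t' := !t) (by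
    rw [if_neg]; push_cast; omega)
  simp only [hsign c hc] at h1 h2
  rw [Finset.sum_Ico_succ_top hc, hmod]
  linarith

/-- The chained Bell inequality for Bob's answers. -/
theorem bob_chain {n : ℕ} (hn : 2 ≤ n) (t : Bool) :
    acceptProb p (bobQuestion 1) (fun x => x .bob = t) ≤
      acceptProb p (bobQuestion 0) (fun x => x .bob = !t) +
      ∑ c ∈ Finset.Ico 1 n, ((gameLoss n p (c : ℤ) (c : ℤ) +
        gameLoss n p (c : ℤ) (((c : ℤ) + 1) % n)) + (gameLoss n p (-(c : ℤ)) (c : ℤ) +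
        gameLoss n p (-(c : ℤ)) (((c : ℤ) + 1) % n))) := by
  have h1 := hp.bob_chain_of_sign hn (Or.inl rfl) t
  have h2 := hp.bob_chain_of_sign hn (Or.inr rfl) t
  -- Positive inputs of Alice test parity `false` and negative ones parity `true`; the sum of the
  -- two chains no longer mentions the parity.
  rw [acceptProb_split _ (fun x => charlieParity x = true),
    acceptProb_split (Q := bobQuestion 0) _ (fun x => charlieParity x = true),
    Finset.sum_add_distrib]
  simp only [one_mul, neg_one_mul] at h1 h2
  simp only [Bool.not_eq_true]
  norm_num at h1 h2
  linarith

end IsNonsignaling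

end Chain

/-! ### The bound for classical players -/

/-- The order Alice, `Charlie₁`, …, `Charlieₖ` of the players other than Bob. -/
def pathPlayer (k : ℕ) : ℕ → Player k
  | 0 => .alice
  | t + 1 => if h : t < k then .charlie ⟨t, h⟩ else .alice

theorem pathPlayer_ne_bob (k t : ℕ) : pathPlayer k t ≠ .bob := by
  cases t with
  | zero => simp [pathPlayer]
  | succ t => simp only [pathPlayer]; split_ifs <;> simp

theorem eq_bob_or_pathPlayer {k : ℕ} (i : Player k) : i = .bob ∨ ∃ t ≤ k, pathPlayer k t = i := by
  cases i with
  | alice => exact Or.inr ⟨0, by omega, rfl⟩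
  | bob => exact Or.inl rfl
  | charlie j => exact Or.inr ⟨j + 1, by omega, by simp [pathPlayer]⟩

theorem card_player (k : ℕ) : Fintype.card (Player k) = k + 2 := by
  let e : Player k ≃ Option (Option (Fin k)) :=
    { toFun := fun i => match i with
        | .alice => none
        | .bob => some none
        | .charlie j => some (some j)
      invFun := fun i => match i with
        | none => .alice
        | some none => .bob
        | some (some j) => .charlie j
      left_inv := by rintro (_ | _ | j) <;> rfl
      right_inv := by rintro (_ | _ | j) <;> rfl }
  rw [Fintype.card_congr e]
  simp

/-- The question that sends the input `b` to Bob and `0` to the players in `s`. -/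
def bobZeroQuestion {k : ℕ} (b : Option ℤ) (s : Set (Player k)) : Question (Player k) :=
  fun i => open Classical in if i = .bob then b else if i ∈ s then some 0 else none

/-- The probability that Bob's answer to `b` differs from the answer of `l` to `0`. -/
def bobDist {k : ℕ} (p : Behaviour (Player k)) (b : ℤ) (l : Player k) : ℝ :=
  acceptProb p (bobZeroQuestion (some b) {l}) (fun x => x .bob ≠ x l)

/-- The probability that the answers of `l` and `l'` to `0` differ. -/
def zeroDist {k : ℕ} (p : Behaviour (Player k)) (l l' : Player k) : ℝ :=
  acceptProb p (bobZeroQuestion none {l, l'}) (fun x => x l ≠ x l')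

/-! ### Disagreement probabilities on input 0 and the triangle inequality -/

section

variable {k : ℕ} {p : Behaviour (Player k)} (hp : IsNonsignaling p)
include hp

theorem IsNonsignaling.zeroDist_eq {s : Set (Player k)} (b : Option ℤ) {l l' : Player k}
    (hl : l ≠ .bob) (hl' : l' ≠ .bob) (h : l ∈ s) (h' : l' ∈ s) :
    acceptProb p (bobZeroQuestion b s) (fun x => x l ≠ x l') = zeroDist p l l' := by
  refine hp.acceptProb_congr_on {l, l'} (fun x x' hx => ?_) fun i hi => ?_
  · rw [hx l (by simp), hx l' (by simp)]
    exact id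
  · simp only [Finset.mem_insert, Finset.mem_singleton] at hi
    rcases hi with rfl | rfl <;> simp [bobZeroQuestion, *]

theorem IsNonsignaling.bobDist_eq {s : Set (Player k)} (b : ℤ) {l : Player k}
    (hl : l ≠ .bob) (h : l ∈ s) :
    acceptProb p (bobZeroQuestion (some b) s) (fun x => x .bob ≠ x l) = bobDist p b l := by
  refine hp.acceptProb_congr_on {.bob, l} (fun x x' hx => ?_) fun i hi => ?_
  · rw [hx l (by simp), hx .bob (by simp)]
    exact id
  · simp only [Finset.mem_insert, Finset.mem_singleton] at hi
    rcases hi with rfl | rfl <;> simp [bobZeroQuestion, *]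

theorem IsNonsignaling.zeroDist_triangle {l l' l'' : Player k} (hl : l ≠ .bob) (hl' : l' ≠ .bob)
    (hl'' : l'' ≠ .bob) : zeroDist p l l'' ≤ zeroDist p l l' + zeroDist p l' l'' := by
  have h := Set.mem_univ (α := Player k)
  rw [← hp.zeroDist_eq none hl hl'' (h _) (h _), ← hp.zeroDist_eq none hl hl' (h _) (h _),
    ← hp.zeroDist_eq none hl' hl'' (h _) (h _)]
  refine hp.acceptProb_le_add fun x => ?_
  generalize x l = a
  generalize x l' = b
  generalize x l'' = c
  revert a b c
  decide

theorem IsNonsignaling.zeroDist_charlie (j : Fin k) :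
    zeroDist p .alice (.charlie j) = consistencyLoss p j := by
  refine hp.acceptProb_congr_on {.alice, .charlie j} (fun x x' hx => ?_) fun i hi => ?_
  · rw [hx .alice (by simp), hx (.charlie j) (by simp)]
    exact id
  · simp only [Finset.mem_insert, Finset.mem_singleton] at hi
    rcases hi with rfl | rfl <;> simp [bobZeroQuestion, consistencyQuestion]

theorem IsNonsignaling.bobDist_alice (n : ℕ) (b : ℤ) :
    bobDist p b .alice = gameLoss n p 0 b := by
  have : gameLoss n p 0 b = acceptProb p (gameQuestion 0 b) (fun x => x .bob ≠ x .alice) :=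
    acceptProb_congr fun x => by simp [GameAccept, eq_comm (a := x .bob)]
  rw [this]
  refine hp.acceptProb_congr_on {.bob, .alice} (fun x x' hx => ?_) fun i hi => ?_
  · rw [hx .alice (by simp), hx .bob (by simp)]
    exact id
  · simp only [Finset.mem_insert, Finset.mem_singleton] at hi
    rcases hi with rfl | rfl <;> simp [bobZeroQuestion, gameQuestion]

end

theorem zeroDist_comm {k : ℕ} (p : Behaviour (Player k)) (l l' : Player k) :
    zeroDist p l l' = zeroDist p l' l := by
  unfold zeroDist
  rw [Set.pair_comm]
  exact acceptProb_congr fun x => ne_comm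

theorem zeroDist_self {k : ℕ} (p : Behaviour (Player k)) (l : Player k) : zeroDist p l l = 0 := by
  simp [zeroDist, acceptProb]

/-! ### Cutting Bob off along the path of the other players -/

namespace NSStrategy

variable {k m : ℕ} {I O Ω : Type*} (S : NSStrategy (Player k) m I O Ω) (ω : Ω)

/-- The resources to which one of the first `t` players on the path has no access. -/
def cutSet (t : ℕ) : Set (Fin m) := {r | ∃ s < t, pathPlayer k s ∉ (S.resource r).members}

/-- Resources newly cut at this step miss the player at position `t`, so the pair formed with Bob
does not see the change. The two path players do not see any cut, since Bob is idle. The triangle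
inequality is applied in the behaviour with the larger cut. -/
theorem bobDist_cut_succ (b : ℤ) (t : ℕ) :
    bobDist (S.cutBehaviour ω .bob (S.cutSet (t + 1))) b (pathPlayer k (t + 1)) ≤
      bobDist (S.cutBehaviour ω .bob (S.cutSet t)) b (pathPlayer k t) +
      zeroDist (S.cutBehaviour ω .bob ∅) (pathPlayer k t) (pathPlayer k (t + 1)) := by
  have hp := S.isNonsignaling_cutBehaviour ω .bob (S.cutSet (t + 1))
  have h1 : bobDist (S.cutBehaviour ω .bob (S.cutSet (t + 1))) b (pathPlayer k t) =
      bobDist (S.cutBehaviour ω .bob (S.cutSet t)) b (pathPlayer k t) := by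
    unfold bobDist acceptProb
    rw [S.cutBehaviour_congr ω (K' := S.cutSet t)]
    intro r
    by_cases hr : pathPlayer k t ∈ (S.resource r).members
    · left
      constructor
      · rintro ⟨s, hs, hsr⟩
        refine ⟨s, ?_, hsr⟩
        rcases Nat.lt_succ_iff_lt_or_eq.1 hs with h | rfl
        · exact h
        · exact absurd hr hsr
      · rintro ⟨s, hs, hsr⟩
        exact ⟨s, by omega, hsr⟩
    · right; right
      intro i hi hib
      have : i ≠ pathPlayer k t := by
        rintro rfl
        exact hr hi
      simp [bobZeroQuestion, hib, this]
  have h2 : zeroDist (S.cutBehaviour ω .bob (S.cutSet (t + 1))) (pathPlayer k t)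
      (pathPlayer k (t + 1)) =
      zeroDist (S.cutBehaviour ω .bob ∅) (pathPlayer k t) (pathPlayer k (t + 1)) := by
    unfold zeroDist acceptProb
    rw [S.cutBehaviour_congr ω (K' := ∅)]
    intro r
    right; left
    simp [bobZeroQuestion]
  have h := Set.mem_univ (α := Player k)
  rw [← h1, ← h2, ← hp.bobDist_eq b (pathPlayer_ne_bob k _) (h _),
    ← hp.bobDist_eq b (pathPlayer_ne_bob k _) (h _),
    ← hp.zeroDist_eq (some b) (pathPlayer_ne_bob k _) (pathPlayer_ne_bob k _) (h _) (h _)]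
  refine hp.acceptProb_le_add fun x => ?_
  generalize x .bob = a
  generalize x (pathPlayer k t) = b
  generalize x (pathPlayer k (t + 1)) = c
  revert a b c
  decide

/-- Consecutive path players are compared through Alice, so every consistency loss is counted at
most twice. The extra term on the left makes the induction close. -/
theorem bobDist_cut_le (n : ℕ) (b : ℤ) (t : ℕ) :
    bobDist (S.cutBehaviour ω .bob (S.cutSet t)) b (pathPlayer k t) +
      zeroDist (S.cutBehaviour ω .bob ∅) .alice (pathPlayer k t) ≤
      gameLoss n (S.cutBehaviour ω .bob ∅) 0 b + 2 * ∑ s ∈ Finset.range t,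
        zeroDist (S.cutBehaviour ω .bob ∅) .alice (pathPlayer k (s + 1)) := by
  have hp := S.isNonsignaling_cutBehaviour ω .bob ∅
  induction t with
  | zero =>
    have : S.cutSet 0 = ∅ := by
      ext r
      simp [cutSet]
    simp [this, pathPlayer, zeroDist_self, hp.bobDist_alice n]
  | succ t ih =>
    have h1 := S.bobDist_cut_succ ω b t
    have h2 := hp.zeroDist_triangle (pathPlayer_ne_bob k t) (l' := .alice) (by simp)
      (pathPlayer_ne_bob k (t + 1))
    rw [zeroDist_comm _ (pathPlayer k t) .alice] at h2
    rw [Finset.sum_range_succ]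
    linarith

theorem bobDist_univ (hS : S.IsLocal (k + 1)) (b : ℤ) :
    bobDist (S.cutBehaviour ω .bob (S.cutSet k)) b (pathPlayer k k) =
      bobDist (S.cutBehaviour ω .bob Set.univ) b (pathPlayer k k) := by
  unfold bobDist acceptProb
  rw [S.cutBehaviour_congr ω (K' := Set.univ)]
  intro r
  by_cases hr : r ∈ S.cutSet k
  · simp [hr]
  · right
    by_cases hb : .bob ∈ (S.resource r).members
    · right
      intro i hi hib
      have hne : i ≠ pathPlayer k k := by
        rintro rfl
        -- An uncut resource contains all earlier path players; with Bob and the last path player it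
        -- would have k + 2 members.
        have : (S.resource r).members = Finset.univ := by
          rw [Finset.eq_univ_iff_forall]
          intro j
          rcases eq_bob_or_pathPlayer j with rfl | ⟨t, ht, rfl⟩
          · exact hb
          · rcases ht.lt_or_eq with h | rfl
            · by_contra hc
              exact hr ⟨t, h, hc⟩
            · exact hi
        have h2 := hS r
        rw [this, Finset.card_univ, card_player] at h2
        omega
      simp [bobZeroQuestion, hib, hne]
    · left
      exact fun h => absurd h hb

/-- The inequality for the losing probabilities, given the shared randomness. -/
theorem one_le_loss (hS : S.IsLocal (k + 1)) {n : ℕ} (hn : 2 ≤ n) :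
    1 ≤ (gameLoss n (S.cutBehaviour ω .bob ∅) 0 0 + gameLoss n (S.cutBehaviour ω .bob ∅) 0 1 +
      ∑ c ∈ Finset.Ico 1 n, ((gameLoss n (S.cutBehaviour ω .bob ∅) (c : ℤ) (c : ℤ) +
        gameLoss n (S.cutBehaviour ω .bob ∅) (c : ℤ) (((c : ℤ) + 1) % n)) +
        (gameLoss n (S.cutBehaviour ω .bob ∅) (-(c : ℤ)) (c : ℤ) +
        gameLoss n (S.cutBehaviour ω .bob ∅) (-(c : ℤ)) (((c : ℤ) + 1) % n)))) +
      4 * ∑ j : Fin k, consistencyLoss (S.cutBehaviour ω .bob ∅) j := by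
  have hp := S.isNonsignaling_cutBehaviour ω .bob ∅
  have hq := S.isNonsignaling_cutBehaviour ω .bob Set.univ
  set p := S.cutBehaviour ω .bob ∅ with hpdef
  set q := S.cutBehaviour ω .bob Set.univ with hqdef
  have hsum : ∑ s ∈ Finset.range k, zeroDist p .alice (pathPlayer k (s + 1)) =
      ∑ j : Fin k, consistencyLoss p j := by
    rw [Finset.sum_range]
    refine Finset.sum_congr rfl fun j _ => ?_
    rw [← hp.zeroDist_charlie]
    simp [pathPlayer]
  have hdist : ∀ b, bobDist q b (pathPlayer k k) ≤
      gameLoss n p 0 b + 2 * ∑ j : Fin k, consistencyLoss p j := by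
    intro b
    rw [← hsum, ← S.bobDist_univ ω hS b]
    have := S.bobDist_cut_le ω n b k
    have h0 : 0 ≤ zeroDist p .alice (pathPlayer k k) := hp.acceptProb_nonneg _
    linarith
  -- Bob alone cannot notice the cuts.
  have hv : ∀ b, acceptProb q (bobZeroQuestion (some b) {pathPlayer k k})
      (fun x => x .bob = true) = acceptProb p (bobQuestion b) (fun x => x .bob = true) := by
    intro b
    rw [hq.acceptProb_congr_on {.bob} (Q' := bobZeroQuestion (some b) ∅)]
    · rw [hp.acceptProb_congr_on {.bob} (Q := bobQuestion b) (Q' := bobZeroQuestion (some b) ∅)]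
      · unfold acceptProb
        rw [hqdef, S.cutBehaviour_congr ω (K' := ∅)]
        intro r
        right; right
        intro i _ hib
        simp [bobZeroQuestion, hib]
      · intro x x' hx
        rw [hx .bob (by simp)]
        exact id
      · simp [bobZeroQuestion, bobQuestion]
    · intro x x' hx
      rw [hx .bob (by simp)]
      exact id
    · simp [bobZeroQuestion]
  -- The last path player cannot see Bob's input, so the same w serves for both.
  have hw : acceptProb q (bobZeroQuestion (some 1) {pathPlayer k k})
      (fun x => x (pathPlayer k k) = true) =
      acceptProb q (bobZeroQuestion (some 0) {pathPlayer k k})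
      (fun x => x (pathPlayer k k) = true) := by
    refine hq.acceptProb_congr_on {pathPlayer k k} (fun x x' hx => ?_) ?_
    · rw [hx _ (by simp)]
      exact id
    · simp [bobZeroQuestion, pathPlayer_ne_bob]
  have hind : ∀ b, bobDist q b (pathPlayer k k) =
      acceptProb p (bobQuestion b) (fun x => x .bob = true) *
        (1 - acceptProb q (bobZeroQuestion (some b) {pathPlayer k k})
          (fun x => x (pathPlayer k k) = true)) +
      (1 - acceptProb p (bobQuestion b) (fun x => x .bob = true)) *
        acceptProb q (bobZeroQuestion (some b) {pathPlayer k k})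
          (fun x => x (pathPlayer k k) = true) := by
    intro b
    obtain ⟨u, v, huv⟩ := S.exists_cutBehaviour_univ_eq_mul ω .bob
      (bobZeroQuestion (some b) {pathPlayer k k})
    rw [← hv]
    exact hq.acceptProb_ne_of_factor (pathPlayer_ne_bob k k) huv
  have hw0 : 0 ≤ acceptProb q (bobZeroQuestion (some 0) {pathPlayer k k})
      (fun x => x (pathPlayer k k) = true) := hq.acceptProb_nonneg _
  have hw1 : 0 ≤ 1 - acceptProb q (bobZeroQuestion (some 0) {pathPlayer k k})
      (fun x => x (pathPlayer k k) = true) := by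
    rw [← hq.acceptProb_not]
    exact hq.acceptProb_nonneg _
  have e0 := hdist 0
  have e1 := hdist 1
  rw [hind] at e0 e1
  rw [hw] at e1
  have c1 := hp.bob_chain hn true
  have c2 := hp.bob_chain hn false
  have hnot : ∀ b, acceptProb p (bobQuestion b) (fun x => x .bob = false) =
      1 - acceptProb p (bobQuestion b) (fun x => x .bob = true) := by
    intro b
    rw [← hp.acceptProb_not]
    exact acceptProb_congr fun x => by simp
  simp only [Bool.not_true, Bool.not_false, hnot] at c1 c2
  -- The two chain inequalities are averaged with weights w and 1 - w and combined with `e0` + `e1`.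
  nlinarith [mul_le_mul_of_nonneg_left c1 hw0, mul_le_mul_of_nonneg_left c2 hw1]

end NSStrategy

/-! ### The winning probability in terms of the losing probabilities -/

theorem sum_Icc_neg_eq {n : ℕ} (hn : 1 ≤ n) (f : ℤ → ℝ) :
    ∑ a ∈ Finset.Icc (-(n : ℤ) + 1) ((n : ℤ) - 1), f a =
      f 0 + ∑ c ∈ Finset.Ico 1 n, (f (c : ℤ) + f (-(c : ℤ))) := by
  induction n, hn using Nat.le_induction with
  | base => simp
  | succ n hn ih =>
    have h : Finset.Icc (-((n + 1 : ℕ) : ℤ) + 1) (((n + 1 : ℕ) : ℤ) - 1) =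
        insert (-(n : ℤ)) (insert (n : ℤ) (Finset.Icc (-(n : ℤ) + 1) ((n : ℤ) - 1))) := by
      ext a
      simp only [Finset.mem_Icc, Finset.mem_insert]
      push_cast
      omega
    rw [h, Finset.sum_insert, Finset.sum_insert, ih, Finset.sum_Ico_succ_top hn]
    · ring
    · simp only [Finset.mem_Icc]; omega
    · simp only [Finset.mem_Icc, Finset.mem_insert]; omega

/-- The total loss over all game questions. -/
def totalGameLoss (n : ℕ) {k : ℕ} (p : Behaviour (Player k)) : ℝ :=
  gameLoss n p 0 0 + gameLoss n p 0 1 +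
    ∑ c ∈ Finset.Ico 1 n, ((gameLoss n p (c : ℤ) (c : ℤ) +
      gameLoss n p (c : ℤ) (((c : ℤ) + 1) % n)) + (gameLoss n p (-(c : ℤ)) (c : ℤ) +
      gameLoss n p (-(c : ℤ)) (((c : ℤ) + 1) % n)))

/-- The choice of p and q gives every pair (a, b) the same weight 1/(2(2n + 3^k - 2)). Only the
complement rule is assumed, so that both classical and quantum behaviours qualify. -/
theorem winProb_eq {n k : ℕ} (hn : 2 ≤ n) {p : Behaviour (Player k)}
    (hp : ∀ Q E, acceptProb p Q (fun x => ¬ E x) = 1 - acceptProb p Q E) :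
    winProb n k p = 1 - (2 * (3 ^ k - 1) / k * ∑ j, consistencyLoss p j + totalGameLoss n p) /
      (2 * (2 * (n : ℝ) + 3 ^ k - 2)) := by
  have hn' : (2 : ℝ) ≤ n := by exact_mod_cast hn
  have h3 : (1 : ℝ) ≤ 3 ^ k := one_le_pow₀ (by norm_num)
  have hc : ∀ j, acceptProb p (consistencyQuestion j) (ConsistencyAccept j) =
      1 - consistencyLoss p j := by
    intro j
    rw [consistencyLoss, hp]
    ring
  have hg : ∀ a b, acceptProb p (gameQuestion a b) (GameAccept n a b) = 1 - gameLoss n p a b := by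
    intro a b
    rw [gameLoss, hp]
    ring
  have ha : ∀ a, aliceInputProb n a = 1 / (2 * n - 1) := by
    intro a
    unfold aliceInputProb zeroProb
    split_ifs
    · rfl
    · have h1 : (2 * n - 1 : ℝ) ≠ 0 := by linarith
      have h2 : (2 * n - 2 : ℝ) ≠ 0 := by linarith
      rw [div_eq_div_iff h2 h1, sub_mul, div_mul_cancel₀ _ h1]
      ring
  have hmod : (1 : ℤ) % n = 1 := Int.emod_eq_of_lt (by norm_num) (by omega)
  have hsum : ∑ a ∈ Finset.Icc (-(n : ℤ) + 1) ((n : ℤ) - 1), aliceInputProb n a *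
        ((1 / 2) * acceptProb p (gameQuestion a |a|) (GameAccept n a |a|) +
         (1 / 2) * acceptProb p (gameQuestion a ((|a| + 1) % n)) (GameAccept n a ((|a| + 1) % n)))
      = 1 / (2 * n - 1) * ((2 * n - 1) - totalGameLoss n p / 2) := by
    simp only [hg, ha, ← Finset.mul_sum]
    congr 1
    rw [sum_Icc_neg_eq (by omega)]
    simp only [abs_neg, Nat.abs_cast, abs_zero, zero_add, hmod]
    have : ∀ c : ℕ, (1 / 2 * (1 - gameLoss n p (c : ℤ) (c : ℤ)) +
        1 / 2 * (1 - gameLoss n p (c : ℤ) (((c : ℤ) + 1) % n)) +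
        (1 / 2 * (1 - gameLoss n p (-(c : ℤ)) (c : ℤ)) +
        1 / 2 * (1 - gameLoss n p (-(c : ℤ)) (((c : ℤ) + 1) % n)))) =
        2 - 1 / 2 * ((gameLoss n p (c : ℤ) (c : ℤ) +
      gameLoss n p (c : ℤ) (((c : ℤ) + 1) % n)) + (gameLoss n p (-(c : ℤ)) (c : ℤ) +
      gameLoss n p (-(c : ℤ)) (((c : ℤ) + 1) % n))) := by
      intro c; ring
    simp only [this]
    rw [Finset.sum_sub_distrib, ← Finset.mul_sum]
    simp only [Finset.sum_const, Nat.card_Ico, nsmul_eq_mul]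
    rw [Nat.cast_sub (by omega)]
    unfold totalGameLoss
    push_cast
    ring
  unfold winProb
  rw [hsum]
  simp only [hc, Finset.sum_sub_distrib, Finset.sum_const, Finset.card_univ, Fintype.card_fin,
    nsmul_eq_mul, mul_one]
  unfold consistencyProb zeroProb
  generalize ∑ j, consistencyLoss p j = e
  generalize totalGameLoss n p = f
  have h1 : (2 * n - 1 : ℝ) ≠ 0 := by linarith
  have h2 : (2 * n + 3 ^ k - 2 : ℝ) ≠ 0 := by linarith
  have hq : (1 + (3 ^ k - 1) * (1 / (2 * n - 1)) : ℝ) = (2 * n + 3 ^ k - 2) / (2 * n - 1) := by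
    field_simp
    ring
  rw [hq]
  -- For k = 0 division by `k` gives 0, but the consistency probability vanishes as well.
  rcases Nat.eq_zero_or_pos k with rfl | hk
  · simp only [pow_zero]
    norm_num
    have h3 : (2 * n + 1 - 2 : ℝ) ≠ 0 := by linarith
    field_simp
    ring
  · have : (k : ℝ) ≠ 0 := by positivity
    field_simp
    ring

/-! ### Averaging over the shared randomness -/

theorem hasSum_acceptProb {P Ω : Type*} [Fintype P] [DecidableEq P] {w : Ω → ℝ}
    {p : Ω → Behaviour P} {q : Behaviour P}
    (h : ∀ Q x, HasSum (fun ω => w ω * p ω Q x) (q Q x)) (Q : Question P)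
    (E : (P → Bool) → Prop) :
    HasSum (fun ω => w ω * acceptProb (p ω) Q E) (acceptProb q Q E) := by
  unfold acceptProb
  simp only [Finset.mul_sum]
  refine hasSum_sum fun x _ => ?_
  split_ifs
  · exact h Q x
  · simp

/-- The winning probability is linear in the behaviour. -/
theorem hasSum_winProb {Ω : Type*} {n k : ℕ} {w : Ω → ℝ}
    {p : Ω → Behaviour (Player k)} {q : Behaviour (Player k)}
    (h : ∀ Q x, HasSum (fun ω => w ω * p ω Q x) (q Q x)) :
    HasSum (fun ω => w ω * winProb n k (p ω)) (winProb n k q) := by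
  have h1 := hasSum_acceptProb h
  have h2 : HasSum (fun ω => consistencyProb n k * ((1 / k) * ∑ j : Fin k,
      w ω * acceptProb (p ω) (consistencyQuestion j) (ConsistencyAccept j)) +
      (1 - consistencyProb n k) * ∑ a ∈ Finset.Icc (-(n : ℤ) + 1) ((n : ℤ) - 1),
        aliceInputProb n a *
        ((1 / 2) * (w ω * acceptProb (p ω) (gameQuestion a |a|) (GameAccept n a |a|)) +
         (1 / 2) * (w ω * acceptProb (p ω) (gameQuestion a ((|a| + 1) % n))
          (GameAccept n a ((|a| + 1) % n))))) (winProb n k q) := by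
    refine HasSum.add (((hasSum_sum fun j _ => h1 _ _).mul_left _).mul_left _)
      ((hasSum_sum fun a _ => ?_).mul_left _)
    exact (((h1 _ _).mul_left _).add ((h1 _ _).mul_left _)).mul_left _
  convert h2 using 1
  funext ω
  unfold winProb
  simp only [Finset.mul_sum, mul_add]
  congr 1
  · exact Finset.sum_congr rfl fun j _ => by ring
  · exact Finset.sum_congr rfl fun a _ => by ring

theorem NSStrategy.winProb_cutBehaviour_le {n k m : ℕ} {I O Ω : Type*}
    (S : NSStrategy (Player k) m I O Ω) (hn : 2 ≤ n) (hS : S.IsLocal (k + 1)) (ω : Ω) :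
    winProb n k (S.cutBehaviour ω .bob ∅) ≤ 1 - 1 / (2 * (2 * (n : ℝ) + 3 ^ k - 2)) := by
  have hn' : (2 : ℝ) ≤ n := by exact_mod_cast hn
  have h3 : (1 : ℝ) ≤ 3 ^ k := one_le_pow₀ (by norm_num)
  have hp := S.isNonsignaling_cutBehaviour ω .bob ∅
  rw [winProb_eq hn fun Q E => hp.acceptProb_not E]
  have h := S.one_le_loss ω hS hn
  rw [← totalGameLoss] at h
  have he : 0 ≤ ∑ j, consistencyLoss (S.cutBehaviour ω .bob ∅) j :=
    Finset.sum_nonneg fun j _ => hp.acceptProb_nonneg _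
  have hle : 4 * ∑ j, consistencyLoss (S.cutBehaviour ω .bob ∅) j ≤
      2 * (3 ^ k - 1) / k * ∑ j, consistencyLoss (S.cutBehaviour ω .bob ∅) j := by
    rcases Nat.eq_zero_or_pos k with rfl | hk
    · simp
    · refine mul_le_mul_of_nonneg_right ?_ he
      rw [le_div_iff₀ (by positivity)]
      -- Bernoulli: 3^k ≥ 1 + 2k, so the weight 2(3^k - 1)/k is at least the 4 of `one_le_loss`.
      have := one_add_mul_le_pow (a := (2 : ℝ)) (by norm_num) k
      norm_num at this
      linarith
  gcongr
  · linarith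
  · linarith

theorem NSStrategy.winProb_le {n k m : ℕ} {I O Ω : Type*}
    (S : NSStrategy (Player k) m I O Ω) (hn : 2 ≤ n) (hS : S.IsLocal (k + 1)) :
    winProb n k S.behaviour ≤ 1 - 1 / (2 * (2 * (n : ℝ) + 3 ^ k - 2)) := by
  have h1 := hasSum_winProb (n := n) (S.hasSum_cutBehaviour .bob)
  have h2 : HasSum (fun ω => (S.seed ω).toReal) 1 := by
    have := ENNReal.summable_toReal (S.seed.tsum_coe ▸ ENNReal.one_ne_top)
    have h := this.hasSum
    rwa [← ENNReal.tsum_toReal_eq (fun ω => S.seed.apply_ne_top ω), S.seed.tsum_coe,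
      ENNReal.toReal_one] at h
  have h3 := h2.mul_right (1 - 1 / (2 * (2 * (n : ℝ) + 3 ^ k - 2)))
  rw [one_mul] at h3
  exact hasSum_le (fun ω => mul_le_mul_of_nonneg_left (S.winProb_cutBehaviour_le hn hS ω)
    ENNReal.toReal_nonneg) h1 h3

/-! ### Quantum behaviours -/

open scoped MatrixOrder in
theorem exists_eq_conjTranspose_mul_self {ι : Type*} [Fintype ι] [DecidableEq ι]
    {A : Matrix ι ι ℂ} (hA : A.PosSemidef) : ∃ B : Matrix ι ι ℂ, A = B.conjTranspose * B := by
  obtain ⟨B, hB⟩ := CStarAlgebra.nonneg_iff_eq_star_mul_self.mp hA.nonneg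
  exact ⟨B, hB⟩

theorem trace_mul_nonneg_of_posSemidef {ι : Type*} [Fintype ι] [DecidableEq ι]
    {A B : Matrix ι ι ℂ} (hA : A.PosSemidef) (hB : B.PosSemidef) : 0 ≤ (A * B).trace := by
  obtain ⟨C, rfl⟩ := exists_eq_conjTranspose_mul_self hB
  rw [← Matrix.mul_assoc, Matrix.trace_mul_comm, ← Matrix.mul_assoc]
  exact (hA.mul_mul_conjTranspose_same C).trace_nonneg

namespace QuantumStrategy

variable {P : Type*} [Fintype P] [DecidableEq P] (S : QuantumStrategy P) (Q : Question P)

theorem effectOn_posSemidef (i : P) (b : Bool) : (S.effectOn Q i b).PosSemidef := by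
  unfold effectOn
  split
  · split_ifs
    · exact Matrix.PosSemidef.zero
    · exact Matrix.PosSemidef.one
  · exact S.effect_posSemidef i _ b

theorem sum_effectOn (i : P) : ∑ b, S.effectOn Q i b = 1 := by
  rw [Fintype.sum_bool, add_comm]
  unfold effectOn
  split
  · simp
  · exact S.effect_sum i _

/-- If each effect is BᴴB, then their tensor product is the same expression in the tensor product of
the B's. -/
theorem jointEffect_posSemidef (x : P → Bool) : (S.jointEffect Q x).PosSemidef := by
  choose B hB using fun i =>
    exists_eq_conjTranspose_mul_self (S.effectOn_posSemidef Q i (x i))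
  suffices h : S.jointEffect Q x = (Matrix.of fun s t => ∏ i, B i (s i) (t i)).conjTranspose *
      Matrix.of fun s t => ∏ i, B i (s i) (t i) by
    rw [h]
    exact Matrix.posSemidef_conjTranspose_mul_self _
  ext s t
  simp only [jointEffect, hB, Matrix.mul_apply, Matrix.conjTranspose_apply, Matrix.of_apply, star_prod,
    ← Finset.prod_mul_distrib]
  rw [Finset.prod_univ_sum, Fintype.piFinset_univ]

theorem sum_jointEffect : ∑ x, S.jointEffect Q x = 1 := by
  ext s t
  simp only [Matrix.sum_apply, jointEffect]
  have h := Finset.prod_univ_sum (fun _ : P => (Finset.univ : Finset Bool))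
    (fun i b => S.effectOn Q i b (s i) (t i))
  rw [Fintype.piFinset_univ] at h
  rw [← h]
  have h1 : ∀ i, ∑ b, S.effectOn Q i b (s i) (t i) =
      (1 : Matrix (Fin (S.dim i)) (Fin (S.dim i)) ℂ) (s i) (t i) := by
    intro i
    rw [← S.sum_effectOn Q i, Matrix.sum_apply]
  simp only [h1]
  by_cases hst : s = t
  · subst hst; simp
  · obtain ⟨i, hi⟩ := Function.ne_iff.1 hst
    rw [Matrix.one_apply_ne hst]
    exact Finset.prod_eq_zero (Finset.mem_univ i) (Matrix.one_apply_ne hi)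

theorem behaviour_nonneg (x : P → Bool) : 0 ≤ S.behaviour Q x :=
  (Complex.le_def.1 (trace_mul_nonneg_of_posSemidef S.state_posSemidef
    (S.jointEffect_posSemidef Q x))).1

theorem acceptProb_true : acceptProb S.behaviour Q (fun _ => True) = 1 := by
  simp only [acceptProb, if_true, behaviour]
  rw [← Complex.re_sum, ← Matrix.trace_sum, ← Finset.mul_sum, S.sum_jointEffect, mul_one,
    S.state_trace, Complex.one_re]

theorem acceptProb_not (E : (P → Bool) → Prop) :
    acceptProb S.behaviour Q (fun x => ¬ E x) = 1 - acceptProb S.behaviour Q E := by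
  have := acceptProb_split (p := S.behaviour) (Q := Q) (fun _ => True) E
  rw [S.acceptProb_true] at this
  simp only [true_and] at this
  linarith

theorem acceptProb_nonneg (E : (P → Bool) → Prop) : 0 ≤ acceptProb S.behaviour Q E := by
  unfold acceptProb
  refine Finset.sum_nonneg fun x _ => ?_
  split_ifs
  · exact S.behaviour_nonneg Q x
  · exact le_rfl

/-- Needed because the real supremum is only informative for a set that is bounded above. -/
theorem winProb_le_one {n k : ℕ} (hn : 2 ≤ n) (S : QuantumStrategy (Player k)) :
    winProb n k S.behaviour ≤ 1 := by
  have hn' : (2 : ℝ) ≤ n := by exact_mod_cast hn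
  have h3 : (1 : ℝ) ≤ 3 ^ k := one_le_pow₀ (by norm_num)
  have hg : ∀ a b, 0 ≤ gameLoss n S.behaviour a b := fun a b => S.acceptProb_nonneg _ _
  rw [winProb_eq hn S.acceptProb_not, sub_le_self_iff]
  refine div_nonneg (add_nonneg (mul_nonneg (div_nonneg (by linarith) (by positivity))
    (Finset.sum_nonneg fun j _ => S.acceptProb_nonneg _ _)) ?_) (by linarith)
  exact add_nonneg (add_nonneg (hg _ _) (hg _ _)) (Finset.sum_nonneg fun c _ =>
    add_nonneg (add_nonneg (hg _ _) (hg _ _)) (add_nonneg (hg _ _) (hg _ _)))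

theorem winProb_le_quantumValue {n k : ℕ} (hn : 2 ≤ n) (S : QuantumStrategy (Player k)) :
    winProb n k S.behaviour ≤ quantumValue n k :=
  le_csSup ⟨1, by rintro _ ⟨T, rfl⟩; exact winProb_le_one hn T⟩ ⟨S, rfl⟩

end QuantumStrategy

/-! ### Measurements on Greenberger–Horne–Zeilinger states -/

/-- The sign `1` for `false` and `-1` for `true`. -/
def boolSign (b : Bool) : ℝ := if b then -1 else 1

/-- The projection for the outcome `b` of the measurement of a qubit in the real direction `θ`. -/
def qubitProjection (θ : ℝ) (b : Bool) : Matrix (Fin 2) (Fin 2) ℝ :=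
  !![(1 + boolSign b * Real.cos θ) / 2, boolSign b * Real.sin θ / 2;
    boolSign b * Real.sin θ / 2, (1 - boolSign b * Real.cos θ) / 2]

theorem qubitProjection_posSemidef (θ : ℝ) (b : Bool) :
    ((qubitProjection θ b).map ((↑) : ℝ → ℂ)).PosSemidef := by
  -- Half angles exhibit the matrix as the rank-one projection onto (cos φ, sin φ) or its orthogonal
  -- vector.
  obtain ⟨φ, rfl⟩ : ∃ φ, θ = 2 * φ := ⟨θ / 2, by ring⟩
  let v : Fin 2 → ℝ := if b then ![-Real.sin φ, Real.cos φ] else ![Real.cos φ, Real.sin φ]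
  have h : (qubitProjection (2 * φ) b).map ((↑) : ℝ → ℂ) =
      Matrix.vecMulVec (fun i => (v i : ℂ)) (star fun i => (v i : ℂ)) := by
    ext i j
    rw [Matrix.map_apply, Matrix.vecMulVec_apply, Pi.star_apply, Complex.star_def,
      Complex.conj_ofReal, ← Complex.ofReal_mul, Complex.ofReal_inj]
    have h1 := Real.sin_sq_add_cos_sq φ
    fin_cases i <;> fin_cases j <;> cases b <;>
      simp [qubitProjection, boolSign, v, Real.cos_two_mul, Real.sin_two_mul] <;> linarith
  rw [h]
  exact Matrix.posSemidef_vecMulVec_self_star _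

theorem qubitProjection_sum (θ : ℝ) :
    (qubitProjection θ false).map ((↑) : ℝ → ℂ) + (qubitProjection θ true).map ((↑) : ℝ → ℂ) =
      1 := by
  ext i j
  fin_cases i <;> fin_cases j <;> simp [qubitProjection, boolSign] <;> ring

section GHZ

variable {P : Type*} [Fintype P] [DecidableEq P]

/-- The unnormalized state vector. -/
def ghzVector (P : Type*) [Fintype P] [DecidableEq P] (s : P → Fin 2) : ℂ :=
  ∑ c : Fin 2, if s = fun _ => c then 1 else 0

theorem sum_ghzVector_mul (f : (P → Fin 2) → ℂ) :
    ∑ s, ghzVector P s * f s = ∑ c : Fin 2, f (fun _ => c) := by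
  simp only [ghzVector, Finset.sum_mul, ite_mul, one_mul, zero_mul]
  rw [Finset.sum_comm]
  simp

theorem star_ghzVector : star (ghzVector P) = ghzVector P := by
  funext s
  simp [ghzVector]

theorem trace_ghz_mul (M : Matrix (P → Fin 2) (P → Fin 2) ℂ) :
    (((1 / 2 : ℂ) • Matrix.vecMulVec (ghzVector P) (star (ghzVector P))) * M).trace =
      1 / 2 * ∑ c : Fin 2, ∑ d : Fin 2, M (fun _ => c) (fun _ => d) := by
  rw [Matrix.smul_mul, Matrix.trace_smul, smul_eq_mul, star_ghzVector]
  congr 1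
  simp only [Matrix.trace, Matrix.diag_apply, Matrix.mul_apply, Matrix.vecMulVec_apply, mul_assoc,
    ← Finset.mul_sum]
  rw [sum_ghzVector_mul (P := P) (fun s => ∑ t, ghzVector P t * M t s)]
  simp only [sum_ghzVector_mul]
  exact Finset.sum_comm

/-- All players measure their qubits of a GHZ state in the directions given by `θ`. -/
def ghzStrategy [Nonempty P] (θ : P → ℤ → ℝ) : QuantumStrategy P where
  dim _ := 2
  state := (1 / 2 : ℂ) • Matrix.vecMulVec (ghzVector P) (star (ghzVector P))
  state_posSemidef := by
    refine (Matrix.posSemidef_vecMulVec_self_star _).smul ?_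
    norm_num [Complex.le_def]
  state_trace := by
    have := trace_ghz_mul (1 : Matrix (P → Fin 2) (P → Fin 2) ℂ)
    rw [mul_one] at this
    rw [this]
    have hc : ∀ c d : Fin 2, ((fun _ => c : P → Fin 2) = fun _ => d) ↔ c = d := fun c d =>
      ⟨fun h => congrFun h (Classical.arbitrary P), fun h => h ▸ rfl⟩
    simp only [Matrix.one_apply, hc, Fin.sum_univ_two]
    norm_num
  effect i a b := (qubitProjection (θ i a) b).map (↑)
  effect_posSemidef i a b := qubitProjection_posSemidef _ _
  effect_sum i a := qubitProjection_sum _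

/-- The real effects of the players in the GHZ strategy. -/
def ghzEffect (θ : P → ℤ → ℝ) (Q : Question P) (i : P) (b : Bool) : Matrix (Fin 2) (Fin 2) ℝ :=
  match Q i with
  | none => if b then 0 else 1
  | some a => qubitProjection (θ i a) b

theorem ghzStrategy_behaviour [Nonempty P] (θ : P → ℤ → ℝ) (Q : Question P) (x : P → Bool) :
    (ghzStrategy θ).behaviour Q x =
      1 / 2 * ∑ c : Fin 2, ∑ d : Fin 2, ∏ i, ghzEffect θ Q i (x i) c d := by
  have h : ∀ i b c d, (ghzStrategy θ).effectOn Q i b c d = (ghzEffect θ Q i b c d : ℂ) := by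
    have hone : ∀ c d : Fin 2, (1 : Matrix (Fin 2) (Fin 2) ℂ) c d =
        ((1 : Matrix (Fin 2) (Fin 2) ℝ) c d : ℂ) := by
      intro c d
      rw [Matrix.one_apply, Matrix.one_apply]
      split_ifs <;> simp
    intro i b c d
    rcases hQ : Q i with _ | a
    · cases b
      · simp only [QuantumStrategy.effectOn, ghzEffect, hQ]
        exact hone c d
      · simp only [QuantumStrategy.effectOn, ghzEffect, hQ]
        exact Complex.ofReal_zero.symm
    · simp only [QuantumStrategy.effectOn, ghzEffect, hQ]
      rfl
  have h2 : ((ghzStrategy θ).state * (ghzStrategy θ).jointEffect Q x).trace =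
      1 / 2 * ∑ c : Fin 2, ∑ d : Fin 2,
        (ghzStrategy θ).jointEffect Q x (fun _ => c) (fun _ => d) := trace_ghz_mul _
  unfold QuantumStrategy.behaviour
  rw [h2, ← Complex.ofReal_re (1 / 2 * _)]
  congr 1
  push_cast
  congr 1
  refine Finset.sum_congr rfl fun c _ => Finset.sum_congr rfl fun d _ => ?_
  exact Finset.prod_congr rfl fun i _ => h i (x i) c d

end GHZ

/-! ### The quantum strategy for the extended chained Bell game -/

instance (k : ℕ) : Nonempty (Player k) := ⟨.alice⟩

/-- The tuple of answers with given components. -/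
def playerTuple {k : ℕ} (y : Bool) (y' : Bool) (z : Fin k → Bool) : Player k → Bool
  | .alice => y
  | .bob => y'
  | .charlie j => z j

theorem sum_player {k : ℕ} (f : (Player k → Bool) → ℝ) :
    ∑ x, f x = ∑ z : Fin k → Bool, ∑ y, ∑ y', f (playerTuple y y' z) := by
  let e : ((Fin k → Bool) × Bool × Bool) ≃ (Player k → Bool) :=
    { toFun := fun w => playerTuple w.2.1 w.2.2 w.1
      invFun := fun x => (fun j => x (.charlie j), x .alice, x .bob)
      left_inv := fun _ => rfl
      right_inv := fun x => by funext i; cases i <;> rfl }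
  rw [← e.sum_comp, Fintype.sum_prod_type]
  simp only [Fintype.sum_prod_type]
  rfl

theorem prod_player {k : ℕ} (f : Player k → ℝ) :
    ∏ i, f i = f .alice * f .bob * ∏ j, f (.charlie j) := by
  let e : Option (Option (Fin k)) ≃ Player k :=
    { toFun := fun i => match i with
        | none => .alice
        | some none => .bob
        | some (some j) => .charlie j
      invFun := fun i => match i with
        | .alice => none
        | .bob => some none
        | .charlie j => some (some j)
      left_inv := by rintro (_ | _ | j) <;> rfl
      right_inv := by rintro (_ | _ | j) <;> rfl }
  rw [← e.prod_comp, Fintype.prod_option, Fintype.prod_option, mul_assoc]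
  rfl

/-- The parity of a tuple of bits. -/
def parity {k : ℕ} (z : Fin k → Bool) : Bool :=
  decide (Odd (Finset.univ.filter fun j : Fin k => z j = true).card)

theorem prod_boolSign {k : ℕ} (z : Fin k → Bool) : ∏ j, boolSign (z j) = boolSign (parity z) := by
  unfold boolSign parity
  rw [Finset.prod_ite, Finset.prod_const, Finset.prod_const_one, mul_one]
  rcases Nat.even_or_odd (Finset.univ.filter fun j : Fin k => z j = true).card with h | h
  · rw [h.neg_one_pow, if_neg]
    simpa using h
  · rw [h.neg_one_pow, if_pos]
    simpa using h

/-- The measurement directions of the players. -/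
def chainAngle (n : ℕ) {k : ℕ} : Player k → ℤ → ℝ
  | .alice, a => if a = n - 1 then -(Real.pi / n) else if a = -(n - 1) then Real.pi / n
      else a * Real.pi / n
  | .bob, b => b * Real.pi / n - Real.pi / (2 * n)
  | .charlie _, c => if c = 0 then 0 else Real.pi / 2

variable {n k : ℕ}

/-- Both measure at angle 0: the projections for different outcomes are diagonal with disjoint
supports, so each entrywise product vanishes. -/
theorem consistencyLoss_ghz (hn : 2 ≤ n) (j : Fin k) :
    consistencyLoss (ghzStrategy (chainAngle n)).behaviour j = 0 := by
  classical
  unfold consistencyLoss acceptProb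
  refine Finset.sum_eq_zero fun x _ => ?_
  split_ifs with hx
  · rw [ghzStrategy_behaviour]
    refine mul_eq_zero_of_right _ (Finset.sum_eq_zero fun c _ => Finset.sum_eq_zero fun d _ => ?_)
    have h0 : chainAngle n (.alice : Player k) 0 = 0 := by
      have h1 : ¬ (0 : ℤ) = (n : ℤ) - 1 := by omega
      have h2 : ¬ (0 : ℤ) = -((n : ℤ) - 1) := by omega
      simp only [chainAngle, h1, h2, if_false]
      simp
    have key : ghzEffect (chainAngle n) (consistencyQuestion j) .alice (x .alice) c d *
        ghzEffect (chainAngle n) (consistencyQuestion j) (.charlie j) (x (.charlie j)) c d = 0 := by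
      have hc : chainAngle n (.charlie j) 0 = 0 := by simp [chainAngle]
      simp only [ghzEffect, consistencyQuestion, if_true, h0, hc]
      unfold ConsistencyAccept at hx
      revert hx
      generalize x .alice = y
      generalize x (.charlie j) = z
      intro hx
      cases y <;> cases z <;> simp at hx <;> fin_cases c <;> fin_cases d <;>
        simp [qubitProjection, boolSign]
    rcases mul_eq_zero.1 key with h | h
    · exact Finset.prod_eq_zero (Finset.mem_univ _) h
    · exact Finset.prod_eq_zero (Finset.mem_univ _) h
  · rfl

theorem ghz_gameQuestion (a b : ℤ) (y y' : Bool) (z : Fin k → Bool) :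
    (ghzStrategy (chainAngle n)).behaviour (gameQuestion a b) (playerTuple y y' z) =
      1 / 2 * ∑ c : Fin 2, ∑ d : Fin 2,
        qubitProjection (chainAngle n (.alice : Player k) a) y c d *
        qubitProjection (chainAngle n (.bob : Player k) b) y' c d *
        ∏ j : Fin k, ghzEffect (chainAngle n) (gameQuestion a b) (.charlie j) (z j) c d := by
  rw [ghzStrategy_behaviour]
  simp only [prod_player]
  rfl

/-- At angle π/2 each Charlie contributes 1/2 on the diagonal and ±1/2 off it, so the parity enters
only as the sign of the coherence between |00⟩ and |11⟩. -/
theorem ghz_gameQuestion_of_ne_zero {a : ℤ} (ha : a ≠ 0) (b : ℤ) (y y' : Bool)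
    (z : Fin k → Bool) :
    (ghzStrategy (chainAngle n)).behaviour (gameQuestion a b) (playerTuple y y' z) =
      (1 / 2) ^ k * ((1 + boolSign y * boolSign y' *
        (Real.cos (chainAngle n (.alice : Player k) a) * Real.cos (chainAngle n (.bob : Player k) b)
        + boolSign (parity z) * (Real.sin (chainAngle n (.alice : Player k) a) *
          Real.sin (chainAngle n (.bob : Player k) b)))) / 4) := by
  have hd : ∀ c : Fin 2, ∏ j : Fin k,
      ghzEffect (chainAngle n) (gameQuestion a b) (.charlie j) (z j) c c = (1 / 2) ^ k := by
    intro c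
    rw [Finset.prod_eq_pow_card (b := 1 / 2)]
    · simp
    · intro j _
      fin_cases c <;> simp [ghzEffect, gameQuestion, ha, chainAngle, qubitProjection]
  have ho : ∀ c d : Fin 2, c ≠ d → ∏ j : Fin k,
      ghzEffect (chainAngle n) (gameQuestion a b) (.charlie j) (z j) c d =
        (1 / 2) ^ k * boolSign (parity z) := by
    intro c d hcd
    rw [← prod_boolSign, ← Fin.prod_const, ← Finset.prod_mul_distrib]
    refine Finset.prod_congr rfl fun j _ => ?_
    fin_cases c <;> fin_cases d <;>
      simp [ghzEffect, gameQuestion, ha, chainAngle, qubitProjection] at hcd ⊢ <;> ring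
  rw [ghz_gameQuestion]
  simp only [Fin.sum_univ_two, hd, ho 0 1 (by decide), ho 1 0 (by decide)]
  simp only [qubitProjection, Matrix.of_apply, Matrix.cons_val_zero, Matrix.cons_val_one,
    Matrix.cons_val', Matrix.cons_val_fin_one]
  ring

/-- Alice's projection at angle 0 is diagonal, which removes the coherence terms; idle Charlies give
the dummy answer. -/
theorem ghz_gameQuestion_zero (hn : 2 ≤ n) (b : ℤ) (y y' : Bool) (z : Fin k → Bool) :
    (ghzStrategy (chainAngle n)).behaviour (gameQuestion 0 b) (playerTuple y y' z) =
      if z = fun _ => false then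
        (1 + boolSign y * boolSign y' * Real.cos (chainAngle n (.bob : Player k) b)) / 4 else 0 := by
  have h0 : chainAngle n (.alice : Player k) 0 = 0 := by
    have h1 : ¬ (0 : ℤ) = (n : ℤ) - 1 := by omega
    have h2 : ¬ (0 : ℤ) = -((n : ℤ) - 1) := by omega
    simp only [chainAngle, h1, h2, if_false]
    simp
  have hd : ∀ c : Fin 2, ∏ j : Fin k,
      ghzEffect (chainAngle n) (gameQuestion 0 b) (.charlie j) (z j) c c =
        if z = fun _ => false then 1 else 0 := by
    intro c
    split_ifs with hz
    · subst hz
      simp [ghzEffect, gameQuestion]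
    · obtain ⟨j, hj⟩ := Function.ne_iff.1 hz
      refine Finset.prod_eq_zero (Finset.mem_univ j) ?_
      simp [ghzEffect, gameQuestion, hj]
  rw [ghz_gameQuestion, h0]
  simp only [Fin.sum_univ_two, hd]
  simp only [qubitProjection, Matrix.of_apply, Matrix.cons_val_zero, Matrix.cons_val_one,
    Matrix.cons_val', Matrix.cons_val_fin_one, Real.sin_zero, Real.cos_zero]
  split_ifs <;> ring

/-- The losing probability on each condition of the chain. -/
def chainLoss (n : ℕ) : ℝ := (1 - Real.cos (Real.pi / (2 * n))) / 2

theorem gameLoss_ghz_zero (hn : 2 ≤ n) {b : ℤ} (hb : b = 0 ∨ b = 1) :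
    gameLoss n (ghzStrategy (chainAngle (k := k) n)).behaviour 0 b = chainLoss n := by
  classical
  have hcos : Real.cos (chainAngle n (.bob : Player k) b) = Real.cos (Real.pi / (2 * n)) := by
    rcases hb with rfl | rfl
    · simp [chainAngle]
    · congr 1
      have : (n : ℝ) ≠ 0 := by positivity
      simp only [chainAngle]
      field_simp
      push_cast
      ring
  unfold gameLoss acceptProb
  rw [sum_player]
  simp only [ghz_gameQuestion_zero hn, hcos]
  rw [Finset.sum_eq_single (fun _ => false)]
  · simp [GameAccept, playerTuple, boolSign, chainLoss]
    ring
  · intro z _ hz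
    simp [hz]
  · simp

/-- The fraction of the tuples of bits with a given parity. -/
def parityFraction (k : ℕ) (s : Bool) : ℝ :=
  ∑ z : Fin k → Bool, if parity z = s then (1 / 2) ^ k else 0

/-- For k = 0 the fractions are 1 and 0 instead of 1/2 each, so the losses for a and -a are only
used together. -/
theorem parityFraction_add (k : ℕ) : parityFraction k false + parityFraction k true = 1 := by
  unfold parityFraction
  rw [← Finset.sum_add_distrib]
  have : ∀ z : Fin k → Bool, ((if parity z = false then (1 / 2 : ℝ) ^ k else 0) +
      if parity z = true then (1 / 2 : ℝ) ^ k else 0) = (1 / 2) ^ k := by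
    intro z
    cases parity z <;> simp
  simp only [this]
  simp

theorem gameLoss_ghz {a : ℤ} (ha : a ≠ 0) (b : ℤ)
    (h : Real.cos (chainAngle n (.alice : Player k) a) *
        Real.cos (chainAngle n (.bob : Player k) b) +
        boolSign (decide (a < 0)) * (Real.sin (chainAngle n (.alice : Player k) a) *
        Real.sin (chainAngle n (.bob : Player k) b)) =
      (if |a| = (n : ℤ) - 1 ∧ b = (n : ℤ) - 1 then -1 else 1) * Real.cos (Real.pi / (2 * n))) :
    gameLoss n (ghzStrategy (chainAngle (k := k) n)).behaviour a b =
      parityFraction k (decide (a < 0)) * chainLoss n := by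
  classical
  unfold gameLoss acceptProb parityFraction
  rw [sum_player, Finset.sum_mul]
  simp only [ghz_gameQuestion_of_ne_zero ha]
  refine Finset.sum_congr rfl fun z _ => ?_
  have hz : ∀ y y', charlieParity (playerTuple y y' z) = parity z := fun _ _ => rfl
  by_cases hp : parity z = decide (a < 0)
  · rw [hp, h]
    simp only [GameAccept, ha, false_and, hz, hp, ne_eq, not_true_eq_false, and_false, false_or,
      not_false_eq_true, true_and, if_true]
    split_ifs
    · simp [playerTuple, boolSign, chainLoss]
      ring
    · simp [playerTuple, boolSign, chainLoss]
      ring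
  · simp [GameAccept, ha, hz, hp]

theorem chainAngle_alice_sign {σ : ℤ} (hσ : σ = 1 ∨ σ = -1) {c : ℕ} (hc : 1 ≤ c) (hcn : c < n) :
    chainAngle n (.alice : Player k) (σ * c) =
      σ * if c + 1 = n then -(Real.pi / n) else c * Real.pi / n := by
  simp only [chainAngle]
  rcases hσ with rfl | rfl
  · by_cases h : c + 1 = n
    · have h1 : (1 : ℤ) * (c : ℤ) = (n : ℤ) - 1 := by omega
      simp [h, h1]
    · have h1 : ¬ (1 : ℤ) * (c : ℤ) = (n : ℤ) - 1 := by omega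
      have h2 : ¬ (1 : ℤ) * (c : ℤ) = -((n : ℤ) - 1) := by omega
      simp only [h, h1, h2, if_false]
      simp
  · by_cases h : c + 1 = n
    · have h1 : ¬ (-1 : ℤ) * (c : ℤ) = (n : ℤ) - 1 := by omega
      have h2 : (-1 : ℤ) * (c : ℤ) = -((n : ℤ) - 1) := by omega
      rw [if_neg h1, if_pos h2, if_pos h]
      simp
    · have h1 : ¬ (-1 : ℤ) * (c : ℤ) = (n : ℤ) - 1 := by omega
      have h2 : ¬ (-1 : ℤ) * (c : ℤ) = -((n : ℤ) - 1) := by omega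
      simp only [h, h1, h2, if_false]
      push_cast
      ring

theorem gameLoss_ghz_chain {σ : ℤ} (hσ : σ = 1 ∨ σ = -1) {c : ℕ} (hc : 1 ≤ c) (hcn : c < n)
    {b : ℤ} (hb : b = c ∨ b = ((c : ℤ) + 1) % n) :
    gameLoss n (ghzStrategy (chainAngle (k := k) n)).behaviour (σ * c) b =
      parityFraction k (decide (σ < 0)) * chainLoss n := by
  have hn0 : (n : ℝ) ≠ 0 := by
    have : n ≠ 0 := by omega
    exact_mod_cast this
  have hsign : (σ * (c : ℤ) < 0 ↔ σ < 0) := by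
    rcases hσ with rfl | rfl <;> constructor <;> intro h <;> omega
  have hne : σ * (c : ℤ) ≠ 0 := by
    rcases hσ with rfl | rfl <;> omega
  have habs : |σ * (c : ℤ)| = c := by
    rcases hσ with rfl | rfl <;> simp
  rw [gameLoss_ghz hne b, decide_eq_decide.2 hsign]
  rw [chainAngle_alice_sign hσ hc hcn, habs, decide_eq_decide.2 hsign]
  generalize hα : (if c + 1 = n then -(Real.pi / n) else c * Real.pi / n : ℝ) = α
  have hcs : Real.cos (σ * α) * Real.cos (chainAngle n (.bob : Player k) b) +
      boolSign (decide (σ < 0)) * (Real.sin (σ * α) *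
        Real.sin (chainAngle n (.bob : Player k) b)) =
      Real.cos (α - chainAngle n (.bob : Player k) b) := by
    -- Reflecting Alice's angle by σ cancels the sign of the tested parity.
    rw [Real.cos_sub]
    rcases hσ with rfl | rfl <;> simp [boolSign]
  rw [hcs]
  subst hα
  have hmod : ((c : ℤ) + 1) % n = if c + 1 = n then 0 else (c : ℤ) + 1 := by
    split_ifs with h
    · subst h
      push_cast
      simp
    · rw [Int.emod_eq_of_lt] <;> omega
  rw [hmod] at hb
  by_cases h : c + 1 = n
  -- Alice's last angle -π/n is (n - 1)π/n shifted by -π. This gives the required disagreement at b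
  -- = n - 1 and leaves her π/(2n) away from Bob's angle for input 0.
  · simp only [h, if_true] at hb ⊢
    have hc' : (c : ℝ) = n - 1 := by
      rw [← h]; push_cast; ring
    rcases hb with rfl | rfl
    · rw [if_pos (by omega), neg_one_mul, ← Real.cos_sub_pi]
      congr 1
      simp only [chainAngle]
      push_cast
      rw [hc']
      field_simp
      ring
    · rw [if_neg (by omega), one_mul, ← Real.cos_neg]
      congr 1
      simp only [chainAngle]
      push_cast
      field_simp
      ring
  · simp only [h, if_false] at hb ⊢
    rw [if_neg (by omega), one_mul]
    rcases hb with rfl | rfl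
    · congr 1
      simp only [chainAngle]
      push_cast
      field_simp
      ring
    · rw [← Real.cos_neg]
      congr 1
      simp only [chainAngle]
      push_cast
      field_simp
      ring

theorem totalGameLoss_ghz (hn : 2 ≤ n) :
    totalGameLoss n (ghzStrategy (chainAngle (k := k) n)).behaviour = 2 * n * chainLoss n := by
  unfold totalGameLoss
  rw [gameLoss_ghz_zero hn (Or.inl rfl), gameLoss_ghz_zero hn (Or.inr rfl)]
  have : ∀ c ∈ Finset.Ico 1 n,
      ((gameLoss n (ghzStrategy (chainAngle (k := k) n)).behaviour (c : ℤ) (c : ℤ) +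
      gameLoss n (ghzStrategy (chainAngle (k := k) n)).behaviour (c : ℤ) (((c : ℤ) + 1) % n)) +
      (gameLoss n (ghzStrategy (chainAngle (k := k) n)).behaviour (-(c : ℤ)) (c : ℤ) +
      gameLoss n (ghzStrategy (chainAngle (k := k) n)).behaviour (-(c : ℤ))
        (((c : ℤ) + 1) % n))) = 2 * chainLoss n := by
    intro c hc
    rw [Finset.mem_Ico] at hc
    have h1 := gameLoss_ghz_chain (k := k) (Or.inl rfl) hc.1 hc.2 (Or.inl rfl)
    have h2 := gameLoss_ghz_chain (k := k) (Or.inl rfl) hc.1 hc.2 (Or.inr rfl)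
    have h3 := gameLoss_ghz_chain (k := k) (Or.inr rfl) hc.1 hc.2 (Or.inl rfl)
    have h4 := gameLoss_ghz_chain (k := k) (Or.inr rfl) hc.1 hc.2 (Or.inr rfl)
    rw [one_mul] at h1 h2
    rw [neg_one_mul] at h3 h4
    rw [h1, h2, h3, h4]
    have := parityFraction_add k
    norm_num
    linear_combination 2 * chainLoss n * this
  rw [Finset.sum_congr rfl this]
  simp only [Finset.sum_const, Nat.card_Ico, nsmul_eq_mul]
  rw [Nat.cast_sub (by omega)]
  push_cast
  ring

theorem winProb_ghz (hn : 2 ≤ n) :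
    winProb n k (ghzStrategy (chainAngle (k := k) n)).behaviour =
      1 - 2 * n * chainLoss n / (2 * (2 * (n : ℝ) + 3 ^ k - 2)) := by
  rw [winProb_eq hn (QuantumStrategy.acceptProb_not _), totalGameLoss_ghz hn]
  simp [consistencyLoss_ghz hn]

/-! ### Numerical estimates -/

theorem two_mul_chainLoss_lt (hn : 2 ≤ n) : 2 * n * chainLoss n < 5 / (4 * n) := by
  have hn' : (0 : ℝ) < n := by positivity
  have h := Real.one_sub_sq_div_two_le_cos (x := Real.pi / (2 * n))
  have hpi : Real.pi ^ 2 < 10 := by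
    have := Real.pi_lt_d2
    have := Real.pi_pos
    nlinarith
  have h2 : chainLoss n ≤ Real.pi ^ 2 / (16 * n ^ 2) := by
    unfold chainLoss
    have : (Real.pi / (2 * n)) ^ 2 / 2 = 2 * (Real.pi ^ 2 / (16 * n ^ 2)) := by
      field_simp
      ring
    linarith
  calc 2 * n * chainLoss n ≤ 2 * n * (Real.pi ^ 2 / (16 * n ^ 2)) := by gcongr
    _ = Real.pi ^ 2 / (8 * n) := by field_simp; ring
    _ < 10 / (8 * n) := by gcongr
    _ = 5 / (4 * n) := by field_simp; ring

theorem lt_quantumValue (hn : 2 ≤ n) {x : ℝ}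
    (hx : 5 / (4 * n) / (2 * (2 * (n : ℝ) + 3 ^ k - 2)) ≤ x) : 1 - x < quantumValue n k := by
  have hn' : (2 : ℝ) ≤ n := by exact_mod_cast hn
  have h3 : (1 : ℝ) ≤ 3 ^ k := one_le_pow₀ (by norm_num)
  refine lt_of_lt_of_le ?_
    (QuantumStrategy.winProb_le_quantumValue hn (ghzStrategy (chainAngle (k := k) n)))
  rw [winProb_ghz hn]
  have := div_lt_div_of_pos_right (two_mul_chainLoss_lt hn)
    (show 0 < 2 * (2 * (n : ℝ) + 3 ^ k - 2) by linarith)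
  linarith

end ChainedBell
end

theorem theoremt (n k : ℕ) (hn : 2 ≤ n) :
    (∀ (m : ℕ) (I O Ω : Type*) (S : ChainedBell.NSStrategy (ChainedBell.Player k) m I O Ω),
      S.IsLocal (k + 1) →
        ChainedBell.winProb n k S.behaviour ≤ 1 - 1 / (2 * (2 * (n : ℝ) + 3 ^ k - 2))) ∧
    1 - 1 / (2 * (2 * (n : ℝ) + 3 ^ k - 2)) < ChainedBell.quantumValue n k ∧
    1 - 1 / (2 * (n : ℝ) ^ 2) < ChainedBell.quantumValue n k := by
  have hn' : (2 : ℝ) ≤ n := by exact_mod_cast hn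
  have h3 : (1 : ℝ) ≤ 3 ^ k := one_le_pow₀ (by norm_num)
  refine ⟨fun m I O Ω S hS => S.winProb_le hn hS, ChainedBell.lt_quantumValue hn ?_,
    ChainedBell.lt_quantumValue hn ?_⟩
  · gcongr
    · linarith
    -- The first comparison only needs 5/(4n) ≤ 1.
    · rw [div_le_one (by positivity)]
      linarith
  · calc 5 / (4 * n) / (2 * (2 * (n : ℝ) + 3 ^ k - 2))
        ≤ 5 / (4 * n) / (2 * (2 * (n : ℝ) - 1)) := by
          exact div_le_div_of_nonneg_left (by positivity) (by linarith) (by linarith)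
      _ ≤ 1 / (2 * (n : ℝ) ^ 2) := by
          -- After using 3^k ≥ 1 and cancelling, this is 10n ≤ 16n - 8.
          rw [div_div, div_le_div_iff₀ (by nlinarith) (by positivity)]
          nlinarith
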